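/- Theorem (Freeness as unfiltered Clifford modules). Let $M$ be a smooth manifold diffeomorphic to $\mathbb{R}^4$, let $C^\infty$ be the algebra of real smooth functions on $M$, and let $W$ be a free $C^\infty$-module of rank $4$ with a symmetric $C^\infty$-bilinear form $\langle -,-\rangle$ that is fiberwise of signature ${-}{+}{+}{+}$, regarded as a chosen representative of a conformal inner product (two forms represent the same conformal inner product iff they are multiples of each other by a positive smooth function). Tensor products are over $C^\infty$ unless indicated otherwise. Definitions. A module derivation of $W$ is a pair $\delta$ of a derivation $\delta$ of the $\mathbb{R}$-algebra $C^\infty$ and an $\mathbb{R}$-linear map $\delta: W\to W$ with $\delta(aw)=\delta(a)w+a\delta(w)$; it also acts on $\Omega=\wedge^4 W$ by the Leibniz rule. Let $\mathrm{CDerEnd}(W)$ be the $C^\infty$-module of those $\delta$ such that for every representative $\langle -,-\rangle'$ of the conformal inner product there is an $f\in C^\infty$ with $\delta(\langle x,y\rangle')=\langle\delta x,y\rangle'+\langle x,\delta y\rangle'+f\langle x,y\rangle'$ for all $x,y\in W$. Let $\mathrm{Cl}$ be the Clifford algebra, generated over $C^\infty$ by $W$ with relations $wv+vw+2\langle v,w\rangle=0$;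 it is $\mathbb{Z}_2$-graded and filtered, where $\mathrm{Cl}^{\leq k}$ is spanned by products of at most $k$ elements of $W$. Set $\bar{\mathcal L}=\mathrm{Cl}\otimes \mathrm{CDerEnd}(W)$, with the $\mathbb{Z}_2$-grading and filtration of the first factor. Let $\bar{\mathcal P}$ be the $\mathrm{Cl}$-module of triples $\delta_{C^\infty}\oplus\delta_W\oplus\delta_\Omega\in \mathrm{Hom}_{\mathbb R}(C^\infty,\mathrm{Cl})\oplus\mathrm{Hom}_{\mathbb R}(W,\mathrm{Cl})\oplus\mathrm{Hom}_{\mathbb R}(\Omega,\mathrm{Cl}\otimes\Omega)$ that satisfy $$\delta_{C^\infty}(aa')=a'\delta_{C^\infty}(a)+a\,\delta_{C^\infty}(a'),\quad \delta_W(aw)=\delta_{C^\infty}(a)w+a\,\delta_W(w),\quad \delta_\Omega(a\eta)=\delta_{C^\infty}(a)\otimes\eta+a\,\delta_\Omega(\eta).$$ Let $f:\bar{\mathcal L}\to\bar{\mathcal P}$ be the $\mathrm{Cl}$-linear map that sends $\omega\otimes\delta$ to the triple $a\mapsto\omega\,\delta(a)$, $w\mapsto \omega\,\delta(w)$, $\eta\mapsto\omega\otimes\delta(\eta)$.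 Set $\bar{\mathcal I}=\ker f$ and $\bar{\mathcal E}=\bar{\mathcal L}/\bar{\mathcal I}$, with the induced $\mathbb{Z}_2$-gradings (and, on $\bar{\mathcal I}$, the induced filtration). For $X=\bar{\mathcal L},\bar{\mathcal I}$ let $X^{\lhd k}$ be the set of elements of $X^{\leq k}$ that have the parity of $k$. Claim. There are $C^\infty$-submodules $A\subset\bar{\mathcal L}^{\lhd 0}$ and $B\subset\bar{\mathcal I}^{\lhd 2}\subset \bar{\mathcal L}^{\lhd 2}$, free of ranks $9$ and $2$ respectively, such that $\omega\otimes x\mapsto\omega x$ defines isomorphisms of $\mathbb{Z}_2$-graded $\mathrm{Cl}$-modules (not necessarily of filtered modules) $$\mathrm{Cl}\otimes(A\oplus B)\simeq\bar{\mathcal L},\qquad \mathrm{Cl}\otimes B\simeq\bar{\mathcal I},\qquad \mathrm{Cl}\otimes A\simeq\bar{\mathcal E},$$ where $A$ and $B$ are regarded as even (the last map being followed by the projection $\bar{\mathcal L}\to\bar{\mathcal E}$). Moreover, let $\theta_0,\ldots,\theta_3$ be any conformally orthonormal basis of $W$, that is, a basis in which some representative of the conformal inner product has matrix $\mathrm{diag}(-1,1,1,1)$.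 Let $\sigma_0=\mathbf 1_W$; for $i,j,k\in\{1,2,3\}$ let $\sigma_i(\theta_0)=\theta_i$, $\sigma_i(\theta_j)=\delta_{ij}\theta_0$, $\sigma_{ij}(\theta_0)=0$, $\sigma_{ij}(\theta_k)=\delta_{jk}\theta_i-\delta_{ik}\theta_j$, extended $C^\infty$-linearly to $W$ and acting as zero on $C^\infty$; and embed $\mathrm{Der}(C^\infty)\hookrightarrow\mathrm{CDerEnd}(W)$ by $X\mapsto(\sum_i f_i\theta_i\mapsto\sum_i X(f_i)\theta_i)$. Then there is a $B$ such that all of the above holds with $A=\mathrm{Der}(C^\infty)\oplus\mathrm{span}_{C^\infty}\{\sigma_0,\sigma_1,\sigma_2,\sigma_3,\sigma_{23}\}$, where $\delta \in \mathrm{CDerEnd}(W)$ is identified with $1\otimes\delta\in\bar{\mathcal L}$. -/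

import Mathlib

open scoped Manifold ContDiff TensorProduct

noncomputable section

namespace GRLie

/-! ### Module derivations and their action on the exterior algebra -/

section Algebraic

variable {R : Type*} [CommRing R] [Algebra ℝ R]
  {W : Type*} [AddCommGroup W] [Module R W] [Module ℝ W] [IsScalarTower ℝ R W]

variable (R W) in
/-- Module derivations of `W`: pairs of a derivation `δ.1` of `R` and an `ℝ`-linear endomorphism
`δ.2` of `W` with `δ (a w) = δ(a) w + a δ(w)`. -/
def derEnd : Submodule R (Derivation ℝ R R × (W →ₗ[ℝ] W)) where
  carrier := {δ | ∀ (a : R) (w : W), δ.2 (a • w) = δ.1 a • w + a • δ.2 w}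
  zero_mem' := by intro a w; simp
  add_mem' := by
    intro δ ε hδ hε a w
    simp only [Prod.fst_add, Prod.snd_add, LinearMap.add_apply, Derivation.add_apply, hδ a w,
      hε a w, add_smul, smul_add]
    abel
  smul_mem' := by
    intro c δ hδ a w
    simp only [Prod.smul_fst, Prod.smul_snd, LinearMap.smul_apply, Derivation.smul_apply, hδ a w,
      smul_add, smul_eq_mul, mul_smul, smul_comm c a]

/-- The dual numbers `E[ε]` over the exterior algebra `E` of `W`, regarded below as an `R`-algebra
through `a ↦ a + ε δ(a)`; only used to construct `extDer`. -/
def ExtDual (_ : derEnd R W) : Type _ :=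
  DualNumber (ExteriorAlgebra R W)

instance (δ : derEnd R W) : Ring (ExtDual δ) :=
  inferInstanceAs (Ring (DualNumber (ExteriorAlgebra R W)))

/-- The element `x + ε y`. -/
def ExtDual.mk (δ : derEnd R W) (x y : ExteriorAlgebra R W) : ExtDual δ :=
  (TrivSqZeroExt.inl x + TrivSqZeroExt.inr y : DualNumber (ExteriorAlgebra R W))

/-- The coefficient `x` of `x + ε y`. -/
def ExtDual.fst {δ : derEnd R W} (z : ExtDual δ) : ExteriorAlgebra R W :=
  TrivSqZeroExt.fst (R := ExteriorAlgebra R W) (M := ExteriorAlgebra R W) z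

/-- The coefficient `y` of `x + ε y`. -/
def ExtDual.snd {δ : derEnd R W} (z : ExtDual δ) : ExteriorAlgebra R W :=
  TrivSqZeroExt.snd (R := ExteriorAlgebra R W) (M := ExteriorAlgebra R W) z

namespace ExtDual

variable {δ : derEnd R W}

theorem ext' {z z' : ExtDual δ} (h₁ : z.fst = z'.fst) (h₂ : z.snd = z'.snd) : z = z' :=
  TrivSqZeroExt.ext h₁ h₂

@[simp] theorem fst_mk (x y : ExteriorAlgebra R W) : (mk δ x y).fst = x := by
  simp [mk, fst]

@[simp] theorem snd_mk (x y : ExteriorAlgebra R W) : (mk δ x y).snd = y := by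
  simp [mk, snd]

@[simp] theorem fst_add (z z' : ExtDual δ) : (z + z').fst = z.fst + z'.fst := rfl

@[simp] theorem snd_add (z z' : ExtDual δ) : (z + z').snd = z.snd + z'.snd := rfl

@[simp] theorem fst_zero : (0 : ExtDual δ).fst = 0 := rfl

@[simp] theorem snd_zero : (0 : ExtDual δ).snd = 0 := rfl

@[simp] theorem fst_one : (1 : ExtDual δ).fst = 1 := rfl

@[simp] theorem snd_one : (1 : ExtDual δ).snd = 0 := rfl

@[simp] theorem fst_mul (z z' : ExtDual δ) : (z * z').fst = z.fst * z'.fst := rfl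

@[simp] theorem snd_mul (z z' : ExtDual δ) :
    (z * z').snd = z.fst * z'.snd + z.snd * z'.fst := rfl

/-- The ring morphism `a ↦ a + ε δ(a)`. -/
def scalarHom (δ : derEnd R W) : R →+* ExtDual δ where
  toFun a := mk δ (algebraMap R _ a) (algebraMap R _ (δ.1.1 a))
  map_one' := by apply ext' <;> simp
  map_zero' := by apply ext' <;> simp
  map_add' a b := by apply ext' <;> simp
  map_mul' a b := by
    apply ext'
    · simp
    · simp only [snd_mk, snd_mul, fst_mk, Derivation.leibniz, smul_eq_mul, map_add, map_mul]
      rw [← map_mul (algebraMap R (ExteriorAlgebra R W)) b, mul_comm b, map_mul]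

instance (δ : derEnd R W) : Algebra R (ExtDual δ) :=
  RingHom.toAlgebra' (scalarHom δ) (by
    intro a z
    apply ext'
    · simp [scalarHom, Algebra.commutes a]
    · simp [scalarHom, Algebra.commutes a, Algebra.commutes (δ.1.1 a), add_comm])

theorem smul_eq (a : R) (z : ExtDual δ) : a • z = scalarHom δ a * z :=
  Algebra.smul_def a z

end ExtDual

/-- The algebra morphism `x ↦ x + ε δ(x)` on the exterior algebra. -/
def extDerHom (δ : derEnd R W) : ExteriorAlgebra R W →ₐ[R] ExtDual δ :=
  ExteriorAlgebra.lift R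
    ⟨{ toFun := fun w => ExtDual.mk δ (ExteriorAlgebra.ι R w) (ExteriorAlgebra.ι R (δ.1.2 w))
       map_add' := by intro v w; apply ExtDual.ext' <;> simp
       map_smul' := by
        intro a w
        rw [RingHom.id_apply, ExtDual.smul_eq]
        apply ExtDual.ext'
        · simp [ExtDual.scalarHom, Algebra.smul_def]
        · simp [ExtDual.scalarHom, Algebra.smul_def, δ.2 a w, add_comm] },
      by
        intro w
        apply ExtDual.ext'
        · simp
        · simp [ExteriorAlgebra.ι_add_mul_swap]⟩

theorem fst_extDerHom (δ : derEnd R W) (x : ExteriorAlgebra R W) : (extDerHom δ x).fst = x := by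
  induction x using ExteriorAlgebra.induction with
  | algebraMap r => rw [AlgHom.commutes]; exact ExtDual.fst_mk _ _
  | ι w => rw [extDerHom, ExteriorAlgebra.lift_ι_apply]; exact ExtDual.fst_mk _ _
  | mul a b ha hb => rw [map_mul, ExtDual.fst_mul, ha, hb]
  | add a b ha hb => rw [map_add, ExtDual.fst_add, ha, hb]

theorem snd_extDerHom_algebraMap (δ : derEnd R W) (a : R) :
    (extDerHom δ (algebraMap R _ a)).snd = algebraMap R _ (δ.1.1 a) := by
  rw [AlgHom.commutes]; exact ExtDual.snd_mk _ _

theorem snd_extDerHom_mul (δ : derEnd R W) (x y : ExteriorAlgebra R W) :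
    (extDerHom δ (x * y)).snd = x * (extDerHom δ y).snd + (extDerHom δ x).snd * y := by
  rw [map_mul, ExtDual.snd_mul, fst_extDerHom, fst_extDerHom]

/-- The degree zero derivation of the exterior algebra `⋀W` induced by a module derivation of `W`:
it extends `δ.1` on `R` and `δ.2` on `W`. -/
def extDer (δ : derEnd R W) : ExteriorAlgebra R W →ₗ[ℝ] ExteriorAlgebra R W where
  toFun x := (extDerHom δ x).snd
  map_add' x y := by rw [map_add, ExtDual.snd_add]
  map_smul' c x := by
    have h : ∀ z : ExteriorAlgebra R W, c • z = algebraMap R _ (algebraMap ℝ R c) * z := by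
      intro z
      rw [← Algebra.smul_def, algebraMap_smul]
    rw [RingHom.id_apply, h, snd_extDerHom_mul, snd_extDerHom_algebraMap, h]
    simp

theorem extDer_algebraMap (δ : derEnd R W) (a : R) :
    extDer δ (algebraMap R _ a) = algebraMap R _ (δ.1.1 a) :=
  snd_extDerHom_algebraMap δ a

theorem extDer_ι (δ : derEnd R W) (w : W) :
    extDer δ (ExteriorAlgebra.ι R w) = ExteriorAlgebra.ι R (δ.1.2 w) := by
  change (extDerHom δ _).snd = _
  rw [extDerHom, ExteriorAlgebra.lift_ι_apply]; exact ExtDual.snd_mk _ _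

theorem extDer_mul (δ : derEnd R W) (x y : ExteriorAlgebra R W) :
    extDer δ (x * y) = extDer δ x * y + x * extDer δ y := by
  rw [add_comm]; exact snd_extDerHom_mul δ x y

theorem extDer_smul (δ : derEnd R W) (a : R) (x : ExteriorAlgebra R W) :
    extDer δ (a • x) = δ.1.1 a • x + a • extDer δ x := by
  simp only [Algebra.smul_def, extDer_mul, extDer_algebraMap]

theorem extDer_add_left (δ ε : derEnd R W) (x : ExteriorAlgebra R W) :
    extDer (δ + ε) x = extDer δ x + extDer ε x := by
  induction x using ExteriorAlgebra.induction with
  | algebraMap r => simp [extDer_algebraMap]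
  | ι w => simp [extDer_ι]
  | mul a b ha hb => simp only [extDer_mul, ha, hb, add_mul, mul_add]; abel
  | add a b ha hb => simp only [map_add, ha, hb]; abel

theorem extDer_smul_left (c : R) (δ : derEnd R W) (x : ExteriorAlgebra R W) :
    extDer (c • δ) x = c • extDer δ x := by
  induction x using ExteriorAlgebra.induction with
  | algebraMap r => simp [extDer_algebraMap, Algebra.smul_def]
  | ι w => simp [extDer_ι]
  | mul a b ha hb => simp only [extDer_mul, ha, hb, smul_add, smul_mul_assoc, mul_smul_comm]
  | add a b ha hb => simp only [map_add, ha, hb, smul_add]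

theorem extDer_mem (δ : derEnd R W) (n : ℕ) {x : ExteriorAlgebra R W} (hx : x ∈ ⋀[R]^n W) :
    extDer δ x ∈ ⋀[R]^n W := by
  induction hx using Submodule.pow_induction_on_left' with
  | algebraMap r => rw [extDer_algebraMap]; exact Submodule.algebraMap_mem _
  | add x y i hx hy hx' hy' => rw [map_add]; exact add_mem hx' hy'
  | mem_mul m hm i x hx hx' =>
    obtain ⟨w, rfl⟩ := hm
    rw [extDer_mul, extDer_ι]
    change _ ∈ LinearMap.range (ExteriorAlgebra.ι R) ^ (i + 1)
    rw [pow_succ']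
    exact add_mem (Submodule.mul_mem_mul (LinearMap.mem_range_self _ _) hx)
      (Submodule.mul_mem_mul (LinearMap.mem_range_self _ _) hx')

/-- The action of module derivations of `W` on the top power `Ω = ⋀⁴ W`, as an `R`-linear map in
the derivation. -/
def extDerTop : derEnd R W →ₗ[R] (⋀[R]^4 W →ₗ[ℝ] ⋀[R]^4 W) where
  toFun δ :=
    { toFun := fun η => ⟨extDer δ η.1, extDer_mem δ 4 η.2⟩
      map_add' := fun x y => Subtype.ext (map_add (extDer δ) x.1 y.1)
      map_smul' := fun c x => Subtype.ext (map_smul (extDer δ) c x.1) }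
  map_add' δ ε := LinearMap.ext fun η => Subtype.ext (extDer_add_left δ ε η.1)
  map_smul' c δ := LinearMap.ext fun η => Subtype.ext (extDer_smul_left c δ η.1)

/-! ### Clifford modules -/

/-- The Clifford algebra of a bilinear form, with the relations `w v + v w + 2 ⟨v, w⟩ = 0`. -/
abbrev Cl (g : LinearMap.BilinForm R W) : Type _ :=
  CliffordAlgebra (-(LinearMap.BilinMap.toQuadraticMap g))

/-- The inclusion `W → Cl`. -/
abbrev clι (g : LinearMap.BilinForm R W) : W →ₗ[R] Cl g :=
  CliffordAlgebra.ι (-(LinearMap.BilinMap.toQuadraticMap g))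

/-- The even (`i = 0`) and the odd (`i = 1`) part of the Clifford algebra. -/
abbrev clParity (g : LinearMap.BilinForm R W) (i : ZMod 2) : Submodule R (Cl g) :=
  CliffordAlgebra.evenOdd (-(LinearMap.BilinMap.toQuadraticMap g)) i

/-- The filtration of the Clifford algebra: `Cl^{≤ k}` is spanned by the products of at most `k`
elements of `W`. -/
def clFiltration (g : LinearMap.BilinForm R W) (k : ℕ) : Submodule R (Cl g) :=
  ⨆ (j : ℕ) (_ : j ≤ k), LinearMap.range (clι g) ^ j

/-- The image of `S ⊗ X` in `Cl ⊗ X`, for a submodule `S` of the Clifford algebra. -/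
def clTensor {g : LinearMap.BilinForm R W} (S : Submodule R (Cl g))
    (X : Type*) [AddCommMonoid X] [Module R X] : Submodule R (Cl g ⊗[R] X) :=
  LinearMap.range (LinearMap.rTensor X S.subtype)

/-- The real-linear maps that `P̸` consists of, before the Leibniz rules are imposed. -/
abbrev PreP (g : LinearMap.BilinForm R W) : Type _ :=
  (R →ₗ[ℝ] Cl g) × (W →ₗ[ℝ] Cl g) × (⋀[R]^4 W →ₗ[ℝ] Cl g ⊗[R] ⋀[R]^4 W)

/-- The Clifford module `P̸`: triples of real-linear maps `R → Cl`, `W → Cl`, `Ω → Cl ⊗ Ω` that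
satisfy the Leibniz rules. -/
def slashP (g : LinearMap.BilinForm R W) : Submodule (Cl g) (PreP g) where
  carrier := {δ | (∀ a b : R, δ.1 (a * b) = b • δ.1 a + a • δ.1 b) ∧
    (∀ (a : R) (w : W), δ.2.1 (a • w) = δ.1 a * clι g w + a • δ.2.1 w) ∧
    (∀ (a : R) (η : ⋀[R]^4 W), δ.2.2 (a • η) = δ.1 a ⊗ₜ[R] η + a • δ.2.2 η)}
  zero_mem' := by simp
  add_mem' := by
    rintro δ ε ⟨h₁, h₂, h₃⟩ ⟨k₁, k₂, k₃⟩
    refine ⟨fun a b => ?_, fun a w => ?_, fun a η => ?_⟩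
    · simp only [Prod.fst_add, LinearMap.add_apply, h₁, k₁, smul_add]; abel
    · simp only [Prod.fst_add, Prod.snd_add, LinearMap.add_apply, h₂, k₂, smul_add, add_mul]; abel
    · simp only [Prod.fst_add, Prod.snd_add, LinearMap.add_apply, h₃, k₃, smul_add,
        TensorProduct.add_tmul]; abel
  smul_mem' := by
    rintro u δ ⟨h₁, h₂, h₃⟩
    refine ⟨fun a b => ?_, fun a w => ?_, fun a η => ?_⟩
    · simp only [Prod.smul_fst, LinearMap.smul_apply, h₁, smul_add, smul_comm u]
    · simp only [Prod.smul_fst, Prod.smul_snd, LinearMap.smul_apply, h₂, smul_eq_mul,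
        mul_add, mul_assoc, mul_smul_comm]
    · simp only [Prod.smul_fst, Prod.smul_snd, LinearMap.smul_apply, h₃, smul_add, smul_comm u,
        TensorProduct.smul_tmul']

/-- A module derivation, viewed as an element of `P̸`. -/
def toSlashP (g : LinearMap.BilinForm R W) (D : Submodule R (derEnd R W)) : D →ₗ[R] slashP g where
  toFun δ :=
    ⟨((Algebra.linearMap R (Cl g)).restrictScalars ℝ ∘ₗ (δ.1.1.1 : R →ₗ[ℝ] R),
      (clι g).restrictScalars ℝ ∘ₗ δ.1.1.2,
      (TensorProduct.mk R (Cl g) (⋀[R]^4 W) 1).restrictScalars ℝ ∘ₗ extDerTop δ.1), by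
      refine ⟨fun a b => ?_, fun a w => ?_, fun a η => ?_⟩
      · simp [Algebra.smul_def, add_comm]
      · simp [δ.1.2 a w, Algebra.smul_def]
      · have h : extDerTop δ.1 (a • η) = δ.1.1.1 a • η + a • extDerTop δ.1 η :=
          Subtype.ext (extDer_smul δ.1 a η.1)
        simp [h, TensorProduct.tmul_add, Algebra.algebraMap_eq_smul_one,
          TensorProduct.smul_tmul]⟩
  map_add' δ ε := by
    apply Subtype.ext
    refine Prod.ext ?_ (Prod.ext ?_ ?_) <;> ext x <;> simp [TensorProduct.tmul_add]
  map_smul' c δ := by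
    apply Subtype.ext
    refine Prod.ext ?_ (Prod.ext ?_ ?_) <;> ext x <;> simp [Algebra.smul_def]

/-- The morphism `f : Cl ⊗ D → P̸`, `u ⊗ δ ↦ u δ`. -/
def slashHom (g : LinearMap.BilinForm R W) (D : Submodule R (derEnd R W)) :
    Cl g ⊗[R] D →ₗ[Cl g] slashP g :=
  TensorProduct.AlgebraTensorModule.lift
    (LinearMap.toSpanSingleton (Cl g) (D →ₗ[R] slashP g) (toSlashP g D))

theorem slashHom_tmul (g : LinearMap.BilinForm R W) (D : Submodule R (derEnd R W)) (u : Cl g)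
    (δ : D) : slashHom g D (u ⊗ₜ[R] δ) = u • toSlashP g D δ :=
  rfl

/-! ### Module derivations determined by a basis -/

/-- An `R`-linear endomorphism of `W`, viewed as a module derivation that annihilates `R`. -/
def vertical (T : W →ₗ[R] W) : derEnd R W :=
  ⟨(0, T.restrictScalars ℝ), by intro a w; simp⟩

/-- The lift of a derivation `X` of `R` to the module derivation
`∑ fᵢ θᵢ ↦ ∑ X(fᵢ) θᵢ`, which annihilates the basis `θ`. -/
def derLift (θ : Module.Basis (Fin 4) R W) : Derivation ℝ R R →ₗ[R] derEnd R W where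
  toFun X :=
    ⟨(X, ∑ i, ((LinearMap.toSpanSingleton R W (θ i)).restrictScalars ℝ) ∘ₗ (X : R →ₗ[ℝ] R) ∘ₗ
        (θ.coord i).restrictScalars ℝ), by
      intro a w
      simp only [LinearMap.sum_apply, LinearMap.comp_apply, LinearMap.restrictScalars_apply,
        map_smul, Derivation.coeFn_coe, smul_eq_mul, Derivation.leibniz,
        LinearMap.toSpanSingleton_apply, add_smul, Finset.sum_add_distrib, Module.Basis.coord_apply]
      rw [add_comm]
      congr 1
      · conv_rhs => rw [← θ.sum_repr w, Finset.smul_sum]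
        exact Finset.sum_congr rfl fun i _ => by rw [smul_smul, mul_comm]
      · rw [Finset.smul_sum]
        exact Finset.sum_congr rfl fun i _ => by rw [mul_smul]⟩
  map_add' X Y := by
    apply Subtype.ext
    refine Prod.ext rfl ?_
    ext w
    simp [add_smul, Finset.sum_add_distrib]
  map_smul' c X := by
    apply Subtype.ext
    refine Prod.ext rfl ?_
    ext w
    simp [mul_smul, Finset.smul_sum]

/-- The boost `σᵢ`, for `i = 1, 2, 3`: `σᵢ(θ₀) = θᵢ` and `σᵢ(θⱼ) = δᵢⱼ θ₀` for `j = 1, 2, 3`. -/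
def boost (θ : Module.Basis (Fin 4) R W) (i : Fin 4) : W →ₗ[R] W :=
  θ.constr R fun k => if k = 0 then θ i else if i = k then θ 0 else 0

/-- The rotation `σᵢⱼ`, for `i, j = 1, 2, 3`: `σᵢⱼ(θₖ) = δⱼₖ θᵢ - δᵢₖ θⱼ`; in particular
`σᵢⱼ(θ₀) = 0`. -/
def rotation (θ : Module.Basis (Fin 4) R W) (i j : Fin 4) : W →ₗ[R] W :=
  θ.constr R fun k => (if j = k then θ i else 0) - (if i = k then θ j else 0)

variable (R) in
/-- The matrix `diag(-1, 1, 1, 1)`. -/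
def eta : Matrix (Fin 4) (Fin 4) R :=
  Matrix.diagonal ![-1, 1, 1, 1]

theorem derLift_compat (θ : Module.Basis (Fin 4) R W) (g : LinearMap.BilinForm R W)
    (hg : ∀ i j, g (θ i) (θ j) = eta R i j) (X : Derivation ℝ R R) (x y : W) :
    X (g x y) = g ((derLift θ X).1.2 x) y + g x ((derLift θ X).1.2 y) := by
  have h : ∀ x y : W, g x y = ∑ i, θ.repr x i * (∑ j, θ.repr y j * eta R i j) := by
    intro x y
    conv_lhs => rw [← θ.sum_repr x, ← θ.sum_repr y]
    simp only [map_sum, map_smul, LinearMap.sum_apply, LinearMap.smul_apply, hg, smul_eq_mul,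
      Finset.mul_sum]
    rw [Finset.sum_comm]
    exact Finset.sum_congr rfl fun i _ => Finset.sum_congr rfl fun j _ => by ring
  have hl : ∀ x i, θ.repr ((derLift θ X).1.2 x) i = X (θ.repr x i) := by
    intro x i
    simp [derLift, Finsupp.single_apply]
  rw [h, h, h]
  simp only [hl]
  simp [eta, Fin.sum_univ_four, Matrix.diagonal_apply]
  ring

theorem boost_compat (θ : Module.Basis (Fin 4) R W) (g : LinearMap.BilinForm R W)
    (hg : ∀ i j, g (θ i) (θ j) = eta R i j) (i : Fin 4) (hi : i ≠ 0) (x y : W) :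
    g (boost θ i x) y + g x (boost θ i y) = 0 := by
  have h : g ∘ₗ boost θ i + g.compl₂ (boost θ i) = 0 := by
    refine θ.ext fun j => θ.ext fun k => ?_
    simp only [boost, LinearMap.add_apply, LinearMap.comp_apply, LinearMap.compl₂_apply,
      Module.Basis.constr_basis, LinearMap.zero_apply]
    fin_cases i <;> first | exact absurd rfl hi | skip
    all_goals fin_cases j <;> fin_cases k <;> simp [hg, eta]
  exact LinearMap.congr_fun₂ h x y

theorem rotation_compat (θ : Module.Basis (Fin 4) R W) (g : LinearMap.BilinForm R W)
    (hg : ∀ i j, g (θ i) (θ j) = eta R i j) (a b : Fin 4) (ha : a ≠ 0) (hb : b ≠ 0) (x y : W) :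
    g (rotation θ a b x) y + g x (rotation θ a b y) = 0 := by
  have h : g ∘ₗ rotation θ a b + g.compl₂ (rotation θ a b) = 0 := by
    refine θ.ext fun j => θ.ext fun k => ?_
    simp only [rotation, LinearMap.add_apply, LinearMap.comp_apply, LinearMap.compl₂_apply,
      Module.Basis.constr_basis, LinearMap.zero_apply]
    fin_cases a <;> first | exact absurd rfl ha | skip
    all_goals fin_cases b <;> first | exact absurd rfl hb | skip
    all_goals fin_cases j <;> fin_cases k <;> simp [hg, eta]
  exact LinearMap.congr_fun₂ h x y

end Algebraic

/-! ### The geometric objects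

`M` is a 4-manifold, `W` is the free rank 4 module of smooth sections of a vector bundle over `M`
(over a manifold diffeomorphic to `ℝ⁴` these are exactly the free `C^∞`-modules of rank 4), and `g`
is the chosen representative of the conformal inner product. -/

section Geometric

/-- The algebra `C^∞` of real smooth functions on `M`. -/
abbrev Cinf (M : Type*) [TopologicalSpace M] [ChartedSpace (EuclideanSpace ℝ (Fin 4)) M] : Type _ :=
  C^∞⟮𝓡 4, M; 𝓘(ℝ, ℝ), ℝ⟯

variable {M : Type*} [TopologicalSpace M] [ChartedSpace (EuclideanSpace ℝ (Fin 4)) M]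
  {W : Type*} [AddCommGroup W] [Module (Cinf M) W] [Module ℝ W] [IsScalarTower ℝ (Cinf M) W]

/-- A `C^∞`-bilinear form that is symmetric and fibrewise of signature `-+++`: over every point `p`
there are four elements of `W` that are orthonormal at `p`. (For `W` of rank 4 their values at `p`
are then a basis of the fibre of `W` at `p`.) -/
structure IsLorentzian (g : LinearMap.BilinForm (Cinf M) W) : Prop where
  symm : ∀ v w : W, g v w = g w v
  signature : ∀ p : M, ∃ w : Fin 4 → W, ∀ i j, (g (w i) (w j)) p = eta ℝ i j

/-- Two inner products represent the same conformal inner product iff they are multiples of each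
other by a positive smooth function. -/
def ConfEquiv (g g' : LinearMap.BilinForm (Cinf M) W) : Prop :=
  ∃ φ : Cinf M, (∀ p, 0 < φ p) ∧ g' = φ • g

/-- The module derivations that preserve the conformal inner product represented by `g`. -/
def cderEnd (g : LinearMap.BilinForm (Cinf M) W) : Submodule (Cinf M) (derEnd (Cinf M) W) where
  carrier := {δ | ∀ g', ConfEquiv g g' → ∃ f : Cinf M, ∀ x y : W,
    δ.1.1 (g' x y) = g' (δ.1.2 x) y + g' x (δ.1.2 y) + f * g' x y}
  zero_mem' := by
    intro g' _
    exact ⟨0, by simp⟩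
  add_mem' := by
    intro δ ε hδ hε g' hg'
    obtain ⟨a, ha⟩ := hδ g' hg'
    obtain ⟨b, hb⟩ := hε g' hg'
    refine ⟨a + b, fun x y => ?_⟩
    have h := congrArg₂ (· + ·) (ha x y) (hb x y)
    simp only [Submodule.coe_add, Prod.fst_add, Prod.snd_add, Derivation.add_apply,
      LinearMap.add_apply, map_add] at h ⊢
    rw [h]
    ring
  smul_mem' := by
    intro c δ hδ g' hg'
    obtain ⟨a, ha⟩ := hδ g' hg'
    refine ⟨c * a, fun x y => ?_⟩
    simp only [Submodule.coe_smul, Prod.smul_fst, Prod.smul_snd, Derivation.smul_apply,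
      LinearMap.smul_apply, map_smul, ha x y, smul_eq_mul]
    ring

theorem exists_mul_eq_one {φ : Cinf M} (hφ : ∀ p, 0 < φ p) :
    ∃ ψ : Cinf M, (∀ p, 0 < ψ p) ∧ φ * ψ = 1 := by
  refine ⟨⟨fun p => (φ p)⁻¹, φ.contMDiff.inv₀ fun p => (hφ p).ne'⟩, fun p => ?_, ?_⟩
  · exact inv_pos.2 (hφ p)
  · ext p
    exact mul_inv_cancel₀ (hφ p).ne'

/-- It suffices to check one representative. -/
theorem mem_cderEnd_of {g g₀ : LinearMap.BilinForm (Cinf M) W} (hg : ConfEquiv g g₀)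
    (δ : derEnd (Cinf M) W) (f : Cinf M)
    (h : ∀ x y : W, δ.1.1 (g₀ x y) = g₀ (δ.1.2 x) y + g₀ x (δ.1.2 y) + f * g₀ x y) :
    δ ∈ cderEnd g := by
  obtain ⟨φ, hφ, rfl⟩ := hg
  rintro _ ⟨χ, hχ, rfl⟩
  obtain ⟨φ', -, hφ'⟩ := exists_mul_eq_one hφ
  obtain ⟨χ', -, hχ'⟩ := exists_mul_eq_one hχ
  have key : ∀ x y : W, (χ • g) x y = (χ * φ') * (φ • g) x y := by
    intro x y
    simp only [LinearMap.smul_apply, smul_eq_mul]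
    linear_combination (-χ * g x y) * hφ'
  have hc : (χ * φ') * (χ' * φ) = 1 := by linear_combination φ * φ' * hχ' + hφ'
  generalize χ * φ' = c at key hc
  generalize χ' * φ = c' at hc
  refine ⟨f + c' * δ.1.1 c, fun x y => ?_⟩
  simp only [key, Derivation.leibniz, smul_eq_mul, h]
  linear_combination (-(δ.1.1 c * (φ • g) x y)) * hc

/-- A basis of `W` that is orthonormal for some representative of the conformal inner product. -/
def IsConfOrthonormal (g : LinearMap.BilinForm (Cinf M) W)
    (θ : Module.Basis (Fin 4) (Cinf M) W) : Prop :=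
  ∃ g', ConfEquiv g g' ∧ ∀ i j, g' (θ i) (θ j) = eta (Cinf M) i j

section Frame

variable {g : LinearMap.BilinForm (Cinf M) W} {θ : Module.Basis (Fin 4) (Cinf M) W}

/-- The map `Der(C^∞) → CDerEnd(W)` given by a conformally orthonormal basis. -/
def derLiftC (hθ : IsConfOrthonormal g θ) :
    Derivation ℝ (Cinf M) (Cinf M) →ₗ[Cinf M] cderEnd g :=
  (derLift θ).codRestrict (cderEnd g) fun X => by
    obtain ⟨g', hg', h⟩ := hθ
    refine mem_cderEnd_of hg' _ 0 fun x y => ?_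
    rw [zero_mul, add_zero]
    exact derLift_compat θ g' h X x y

/-- `σ₀`, the identity of `W`. -/
def sigmaDil (g : LinearMap.BilinForm (Cinf M) W) : cderEnd g :=
  ⟨vertical LinearMap.id, mem_cderEnd_of (g₀ := g) ⟨1, by simp, by simp⟩ _ (-2) fun x y => by
    simp [vertical]; ring⟩

/-- The boosts `σ₁, σ₂, σ₃`. -/
def sigmaBoost (hθ : IsConfOrthonormal g θ) (i : Fin 4) (hi : i ≠ 0) : cderEnd g :=
  ⟨vertical (boost θ i), by
    obtain ⟨g', hg', h⟩ := hθ
    refine mem_cderEnd_of hg' _ 0 fun x y => ?_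
    rw [zero_mul, add_zero]
    exact (boost_compat θ g' h i hi x y).symm⟩

/-- The rotations `σᵢⱼ` with `i, j = 1, 2, 3`. -/
def sigmaRot (hθ : IsConfOrthonormal g θ) (i j : Fin 4) (hi : i ≠ 0) (hj : j ≠ 0) : cderEnd g :=
  ⟨vertical (rotation θ i j), by
    obtain ⟨g', hg', h⟩ := hθ
    refine mem_cderEnd_of hg' _ 0 fun x y => ?_
    rw [zero_mul, add_zero]
    exact (rotation_compat θ g' h i j hi hj x y).symm⟩

end Frame

/-! ### The Clifford modules `L̸`, `I̸`, `E̸` -/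

variable (g : LinearMap.BilinForm (Cinf M) W)

/-- `L̸ = Cl ⊗ CDerEnd(W)`. -/
abbrev slashL : Type _ := Cl g ⊗[Cinf M] cderEnd g

/-- The even and odd part of `L̸`. -/
def slashLParity (i : ZMod 2) : Submodule (Cinf M) (slashL g) :=
  clTensor (clParity g i) (cderEnd g)

/-- The filtration of `L̸`. -/
def slashLFiltration (k : ℕ) : Submodule (Cinf M) (slashL g) :=
  clTensor (clFiltration g k) (cderEnd g)

/-- `L̸^{⊲ k}`: the elements of `L̸^{≤ k}` that have the parity of `k`. -/
def slashLTri (k : ℕ) : Submodule (Cinf M) (slashL g) :=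
  slashLFiltration g k ⊓ slashLParity g (k : ZMod 2)

/-- `I̸`, the kernel of `f : L̸ → P̸`. -/
def slashI : Submodule (Cl g) (slashL g) :=
  LinearMap.ker (slashHom g (cderEnd g))

/-- The even and odd part of `I̸`. -/
def slashIParity (i : ZMod 2) : Submodule (Cinf M) (slashI g) :=
  (slashLParity g i).comap ((slashI g).subtype.restrictScalars (Cinf M))

/-- `I̸^{⊲ k}`, as a submodule of `L̸`. -/
def slashITri (k : ℕ) : Submodule (Cinf M) (slashL g) :=
  (slashI g).restrictScalars (Cinf M) ⊓ slashLTri g k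

/-- `E̸ = L̸ / I̸`. -/
abbrev slashE : Type _ := slashL g ⧸ slashI g

/-- The even and odd part of `E̸`. -/
def slashEParity (i : ZMod 2) : Submodule (Cinf M) (slashE g) :=
  (slashLParity g i).map ((slashI g).mkQ.restrictScalars (Cinf M))

variable {g}

/-- A `Cl`-linear isomorphism from `Cl ⊗ X` (with `X` even) to a `ℤ₂`-graded `Cl`-module `Y`
respects the gradings. -/
def IsGradedIso {X Y : Type*} [AddCommMonoid X] [Module (Cinf M) X] [AddCommMonoid Y]
    [Module (Cl g) Y] [Module (Cinf M) Y] [IsScalarTower (Cinf M) (Cl g) Y]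
    (parity : ZMod 2 → Submodule (Cinf M) Y) (e : (Cl g ⊗[Cinf M] X) ≃ₗ[Cl g] Y) : Prop :=
  ∀ i : ZMod 2, (clTensor (clParity g i) X).map
    ((e : (Cl g ⊗[Cinf M] X) →ₗ[Cl g] Y).restrictScalars (Cinf M)) = parity i

/-- `A ⊆ L̸^{⊲ 0}` and `B ⊆ I̸^{⊲ 2}` are free of ranks 9 and 2 and `u ⊗ x ↦ u x` defines
isomorphisms `Cl ⊗ (A ⊕ B) ≃ L̸`, `Cl ⊗ B ≃ I̸`, `Cl ⊗ A ≃ E̸` of `ℤ₂`-graded `Cl`-modules. -/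
structure IsFreePair (A B : Submodule (Cinf M) (slashL g)) : Prop where
  le_A : A ≤ slashLTri g 0
  le_B : B ≤ slashITri g 2
  free_A : Module.Free (Cinf M) A
  free_B : Module.Free (Cinf M) B
  rank_A : Module.finrank (Cinf M) A = 9
  rank_B : Module.finrank (Cinf M) B = 2
  iso_L : ∃ e : (Cl g ⊗[Cinf M] (A × B)) ≃ₗ[Cl g] slashL g,
    IsGradedIso (slashLParity g) e ∧
      ∀ (u : Cl g) (a : A) (b : B), e (u ⊗ₜ[Cinf M] (a, b)) = u • ((a : slashL g) + b)
  iso_I : ∃ e : (Cl g ⊗[Cinf M] B) ≃ₗ[Cl g] slashI g,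
    IsGradedIso (slashIParity g) e ∧
      ∀ (u : Cl g) (b : B), (e (u ⊗ₜ[Cinf M] b) : slashL g) = u • (b : slashL g)
  iso_E : ∃ e : (Cl g ⊗[Cinf M] A) ≃ₗ[Cl g] slashE g,
    IsGradedIso (slashEParity g) e ∧
      ∀ (u : Cl g) (a : A), e (u ⊗ₜ[Cinf M] a) = (slashI g).mkQ (u • (a : slashL g))

/-- The submodule `Der(C^∞) ⊕ span {σ₀, σ₁, σ₂, σ₃, σ₂₃}` of `CDerEnd(W) = 1 ⊗ CDerEnd(W) ⊆ L̸`,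
for a conformally orthonormal basis. -/
def frameA {θ : Module.Basis (Fin 4) (Cinf M) W} (hθ : IsConfOrthonormal g θ) :
    Submodule (Cinf M) (slashL g) :=
  (LinearMap.range (derLiftC hθ) ⊔
    Submodule.span (Cinf M) {sigmaDil g, sigmaBoost hθ 1 (by decide), sigmaBoost hθ 2 (by decide),
      sigmaBoost hθ 3 (by decide), sigmaRot hθ 2 3 (by decide) (by decide)}).map
    (TensorProduct.mk (Cinf M) (Cl g) (cderEnd g) 1)

end Geometric

end GRLie

end

open GRLie

/-!
Fix a conformally orthonormal basis `θ` of `W` and write `tᵢ` for `θᵢ` in the Clifford algebra. The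
orthonormal representative is a multiple of `g` by a positive function, so the `tᵢ` are units that
anticommute pairwise and have central squares (`LorentzRelations`).

The derivations of `C^∞` are free on the coordinate derivations of a global chart, by Hadamard's
lemma (`derivation_eq_sum`). The conformal Killing equation says that the matrix of a conformal
module derivation is a multiple of the identity plus an infinitesimal Lorentz transformation. Hence
`CDerEnd(W)` is free on eleven elements: four lifted derivations, `σ₀`, three boosts `σᵢ`, and three
rotations `σᵢⱼ` (`exists_basis_adaptedFamily`).

Over `Cl` there are syzygies among the boosts and rotations (`syzygy_mem_ker`):
`tᵢtⱼ ⊗ σᵢⱼ - tᵢt₀ ⊗ σᵢ + tₖt₀ ⊗ σₖ - tⱼtₖ ⊗ σⱼₖ` annihilates functions and the volume form, as the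
`σ`'s involved are traceless, and it annihilates each `θₗ` by the Clifford relations. For
`(i, j, k) = (1, 2, 3)` and `(1, 3, 2)` the leading coefficients `t₁t₂` and `t₁t₃` are units. The
two syzygies can therefore replace `1 ⊗ σ₁₂` and `1 ⊗ σ₁₃` in the `Cl`-basis of `L̸`
(`exists_basis_adapted`); they span `B`, and the other nine elements of the basis span `A`. A
`Cl`-combination of these nine that is in `I̸` vanishes (`eq_zero_of_sum_mem_ker`): evaluate it on
coordinate functions, on the volume form and on the `θₗ`. So `I̸` is exactly the `Cl`-span of `B`,
and the three isomorphisms follow. They are graded because `A` and `B` consist of even elements and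
`Cl ⊗ N` is the direct sum of its two parities (`exists_graded_equivs`).

It remains to see that a conformally orthonormal basis exists
(`IsLorentzian.exists_orthonormal_basis`). Fibrewise the light cone has two halves, and as `M` is
simply connected the double covering of `M` by these halves has a section
(`exists_timeOrientation`). The timelike vectors in one half are a convex set, so a partition of
unity gives an element of `W` that is timelike everywhere. As the rank is four, its quaternionic
multiples complete it to a frame (`exists_frame`). The orthogonal complement of a timelike vector is
positive definite, so the Gram-Schmidt process applies to this frame.
-/

noncomputable section

namespace GRLie

/-! ### Hadamard's lemma -/

section Hadamard
open MeasureTheory intervalIntegral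

theorem hasFDerivAt_integral_of_contDiff {E F : Type} [NormedAddCommGroup E] [NormedSpace ℝ E]
    [NormedAddCommGroup F] [NormedSpace ℝ F] [ProperSpace E] [CompleteSpace F]
    {f : E × ℝ → F} (hf : ContDiff ℝ ∞ f) (x₀ : E) :
    HasFDerivAt (fun x => ∫ t in (0 : ℝ)..1, f (x, t))
      (∫ t in (0 : ℝ)..1, (fderiv ℝ f (x₀, t)).comp (ContinuousLinearMap.inl ℝ E ℝ)) x₀ := by
  set f' : E → ℝ → E →L[ℝ] F := fun x t =>
    (fderiv ℝ f (x, t)).comp (ContinuousLinearMap.inl ℝ E ℝ) with hf'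
  have hf'c : Continuous (fun p : E × ℝ => f' p.1 p.2) :=
    ((hf.continuous_fderiv (by simp)).clm_comp continuous_const)
  obtain ⟨C, hC⟩ := ((isCompact_closedBall x₀ 1).prod
    (isCompact_Icc (a := (0 : ℝ)) (b := 1))).exists_bound_of_continuousOn hf'c.continuousOn
  refine (hasFDerivAt_integral_of_dominated_of_fderiv_le (μ := volume) (F := fun x t => f (x, t))
    (F' := f') (bound := fun _ => C) (s := Metric.closedBall x₀ 1)
    (Metric.closedBall_mem_nhds x₀ one_pos) ?_ ?_ ?_ ?_ ?_ ?_)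
  · exact Filter.Eventually.of_forall fun x =>
      (hf.continuous.comp (Continuous.prodMk_right x)).aestronglyMeasurable
  · exact (hf.continuous.comp (Continuous.prodMk_right x₀)).intervalIntegrable _ _
  · exact (hf'c.comp (Continuous.prodMk_right x₀)).aestronglyMeasurable
  · refine Filter.Eventually.of_forall fun t ht x hx => hC (x, t) ⟨hx, ?_⟩
    rw [Set.uIoc_of_le zero_le_one] at ht
    exact ⟨ht.1.le, ht.2⟩
  · exact intervalIntegrable_const
  · refine Filter.Eventually.of_forall fun t _ x _ => ?_
    have h1 : HasFDerivAt f (fderiv ℝ f (x, t)) (x, t) :=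
      (hf.differentiable (by simp) (x, t)).hasFDerivAt
    have h2 : HasFDerivAt (fun y : E => (y, t)) (ContinuousLinearMap.inl ℝ E ℝ) x :=
      hasFDerivAt_prodMk_left x t
    exact h1.comp x h2

theorem contDiff_integral_of_contDiff {E F : Type} [NormedAddCommGroup E] [NormedSpace ℝ E]
    [NormedAddCommGroup F] [NormedSpace ℝ F] [ProperSpace E] [CompleteSpace F]
    {f : E × ℝ → F} (hf : ContDiff ℝ ∞ f) :
    ContDiff ℝ ∞ (fun x => ∫ t in (0 : ℝ)..1, f (x, t)) := by
  rw [contDiff_infty]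
  intro n
  induction n generalizing F with
  | zero =>
    rw [Nat.cast_zero, contDiff_zero]
    exact continuous_iff_continuousAt.2 fun x =>
      (hasFDerivAt_integral_of_contDiff hf x).continuousAt
  | succ n ih =>
    rw [Nat.cast_succ, contDiff_succ_iff_hasFDerivAt]
    refine ⟨_, ih (F := E →L[ℝ] F)
      (f := fun p => (fderiv ℝ f p).comp (ContinuousLinearMap.inl ℝ E ℝ)) ?_,
      hasFDerivAt_integral_of_contDiff hf⟩
    exact (hf.fderiv_right (m := ∞) le_rfl).clm_comp contDiff_const

/-- Hadamard's lemma: differentiate `f` along the segment from `p` to `x` and integrate. -/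
theorem hadamard {ι : Type} [Fintype ι] {f : EuclideanSpace ℝ ι → ℝ} (hf : ContDiff ℝ ∞ f)
    (p : EuclideanSpace ℝ ι) :
    ∃ h : ι → EuclideanSpace ℝ ι → ℝ, (∀ i, ContDiff ℝ ∞ (h i)) ∧
      ∀ x, f x = f p + ∑ i, (x i - p i) * h i x := by
  classical
  refine ⟨fun i x => ∫ t in (0 : ℝ)..1, fderiv ℝ f (p + t • (x - p)) (EuclideanSpace.single i 1),
    fun i => ?_, fun x => ?_⟩
  · refine contDiff_integral_of_contDiff
      (f := fun q : EuclideanSpace ℝ ι × ℝ =>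
        fderiv ℝ f (p + q.2 • (q.1 - p)) (EuclideanSpace.single i 1)) ?_
    refine ContDiff.clm_apply ((hf.fderiv_right (m := ∞) le_rfl).comp ?_) contDiff_const
    fun_prop
  · have h1 : ∀ t : ℝ, HasDerivAt (fun t : ℝ => f (p + t • (x - p)))
        (fderiv ℝ f (p + t • (x - p)) (x - p)) t := by
      intro t
      have h2 : HasDerivAt (fun t : ℝ => p + t • (x - p)) (x - p) t := by
        simpa using ((hasDerivAt_id t).smul_const (x - p)).const_add p
      exact (hf.differentiable (by simp) _).hasFDerivAt.comp_hasDerivAt t h2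
    have hc : Continuous fun t : ℝ => fderiv ℝ f (p + t • (x - p)) :=
      (hf.continuous_fderiv (by simp)).comp (by fun_prop)
    have h3 := integral_eq_sub_of_hasDerivAt (a := 0) (b := 1) (fun t _ => h1 t)
      ((hc.clm_apply continuous_const).intervalIntegrable _ _)
    have h4 : ∀ t : ℝ, fderiv ℝ f (p + t • (x - p)) (x - p) =
        ∑ i, (x i - p i) * fderiv ℝ f (p + t • (x - p)) (EuclideanSpace.single i 1) := by
      intro t
      have h5 : x - p = ∑ i, (x i - p i) • EuclideanSpace.single i (1 : ℝ) := by
        ext j; simp [Finset.sum_apply, Pi.single_apply]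
      generalize fderiv ℝ f (p + t • (x - p)) = l
      rw [h5]
      simp
    simp only [h4] at h3
    rw [intervalIntegral.integral_finsetSum] at h3
    · simp only [intervalIntegral.integral_const_mul] at h3
      rw [h3]; simp
    · intro i _
      exact (continuous_const.mul (hc.clm_apply continuous_const)).intervalIntegrable _ _

end Hadamard

/-! ### Derivations of the algebra of smooth functions -/

section Derivations

variable {M : Type*} [TopologicalSpace M] [ChartedSpace (EuclideanSpace ℝ (Fin 4)) M]

/-- The coordinate functions of a global chart. -/
def coordFun (Φ : M ≃ₘ⟮𝓡 4, 𝓡 4⟯ EuclideanSpace ℝ (Fin 4)) (i : Fin 4) : Cinf M :=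
  ⟨fun p => Φ p i,
    (EuclideanSpace.proj (𝕜 := ℝ) i :
      EuclideanSpace ℝ (Fin 4) →L[ℝ] ℝ).contDiff.contMDiff.comp Φ.contMDiff⟩

theorem contDiff_comp_symm (Φ : M ≃ₘ⟮𝓡 4, 𝓡 4⟯ EuclideanSpace ℝ (Fin 4)) (f : Cinf M) :
    ContDiff ℝ ∞ (fun x => f (Φ.symm x)) :=
  contMDiff_iff_contDiff.1 (f.contMDiff.comp Φ.symm.contMDiff)

/-- The coordinate derivations of a global chart. -/
def coordDer (Φ : M ≃ₘ⟮𝓡 4, 𝓡 4⟯ EuclideanSpace ℝ (Fin 4)) (i : Fin 4) :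
    Derivation ℝ (Cinf M) (Cinf M) :=
  Derivation.mk'
    { toFun := fun f =>
        ⟨fun p => fderiv ℝ (fun x => f (Φ.symm x)) (Φ p) (EuclideanSpace.single i 1),
        ContMDiff.comp (I' := 𝓡 4)
          (g := fun x => fderiv ℝ (fun x => f (Φ.symm x)) x (EuclideanSpace.single i 1))
          (ContDiff.contMDiff
            (((contDiff_comp_symm Φ f).fderiv_right (m := ∞) le_rfl).clm_apply contDiff_const))
          Φ.contMDiff⟩
      map_add' := by
        intro f h
        ext p
        have e : (fun x => (f + h) (Φ.symm x)) =
            (fun x => f (Φ.symm x)) + fun x => h (Φ.symm x) := rfl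
        change fderiv ℝ (fun x => (f + h) (Φ.symm x)) (Φ p) _ = fderiv ℝ _ _ _ + fderiv ℝ _ _ _
        rw [e, fderiv_add ((contDiff_comp_symm Φ f).differentiable (by simp) _)
          ((contDiff_comp_symm Φ h).differentiable (by simp) _)]
        rfl
      map_smul' := by
        intro c f
        ext p
        have e : (fun x => (c • f) (Φ.symm x)) = c • fun x => f (Φ.symm x) := rfl
        change fderiv ℝ (fun x => (c • f) (Φ.symm x)) (Φ p) _ = c • fderiv ℝ _ _ _
        rw [e, fderiv_const_smul ((contDiff_comp_symm Φ f).differentiable (by simp) _)]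
        rfl }
    (by
      intro f h
      ext p
      have e : (fun x => (f * h) (Φ.symm x)) =
          (fun x => f (Φ.symm x)) * fun x => h (Φ.symm x) := rfl
      change fderiv ℝ (fun x => (f * h) (Φ.symm x)) (Φ p) _ =
        f p * fderiv ℝ _ _ _ + h p * fderiv ℝ _ _ _
      rw [e, fderiv_mul ((contDiff_comp_symm Φ f).differentiable (by simp) _)
          ((contDiff_comp_symm Φ h).differentiable (by simp) _)]
      simp)

theorem coordDer_coordFun (Φ : M ≃ₘ⟮𝓡 4, 𝓡 4⟯ EuclideanSpace ℝ (Fin 4)) (i j : Fin 4) :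
    coordDer Φ i (coordFun Φ j) = if i = j then 1 else 0 := by
  have e : (fun x => coordFun Φ j (Φ.symm x)) =
      (EuclideanSpace.proj (𝕜 := ℝ) j : EuclideanSpace ℝ (Fin 4) →L[ℝ] ℝ) := by
    ext x
    change (Φ (Φ.symm x)) j = x j
    rw [Φ.apply_symm_apply]
  ext p
  change fderiv ℝ (fun x => coordFun Φ j (Φ.symm x)) (Φ p) (EuclideanSpace.single i 1) = _
  rw [e, ContinuousLinearMap.fderiv]
  by_cases h : i = j
  · subst h; simp
  · rw [if_neg h]; simpa using fun h' => absurd h'.symm h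

/-- A derivation of the algebra of smooth functions is determined by its values on the coordinate
functions of a global chart. -/
theorem derivation_eq_sum (Φ : M ≃ₘ⟮𝓡 4, 𝓡 4⟯ EuclideanSpace ℝ (Fin 4))
    (X : Derivation ℝ (Cinf M) (Cinf M)) :
    X = ∑ i, X (coordFun Φ i) • coordDer Φ i := by
  -- By Hadamard's lemma, the value of `Y f` at `p` is a combination of the values of `Y` on the
  -- coordinates, with coefficients that do not depend on `Y`.
  have key : ∀ f : Cinf M, ∀ p : M, ∃ c : Fin 4 → ℝ, ∀ Y : Derivation ℝ (Cinf M) (Cinf M),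
      Y f p = ∑ i, Y (coordFun Φ i) p * c i := by
    intro f p
    obtain ⟨h, hh, hf⟩ := hadamard (contDiff_comp_symm Φ f) (Φ p)
    let k : Fin 4 → Cinf M := fun i => ⟨fun q => h i (Φ q), (hh i).contMDiff.comp Φ.contMDiff⟩
    have e : f = algebraMap ℝ (Cinf M) (f p) +
        ∑ i, (coordFun Φ i - algebraMap ℝ (Cinf M) (Φ p i)) * k i := by
      ext q
      have := hf (Φ q)
      simp only [Φ.symm_apply_apply] at this
      rw [this]
      simp [Fin.sum_univ_four]
      rfl
    refine ⟨fun i => h i (Φ p), fun Y => ?_⟩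
    have e2 := congrArg (fun f => Y f p) e
    simp only [map_add, map_sum, Derivation.leibniz, map_sub, Derivation.map_algebraMap] at e2
    rw [e2]
    have z : ∀ i, (coordFun Φ i - algebraMap ℝ (Cinf M) (Φ p i)) p = 0 := by
      intro i
      change (Φ p) i - (Φ p) i = 0
      ring
    simp [Fin.sum_univ_four] at z ⊢
    simp only [z, zero_mul, zero_add]
    change h 0 (Φ p) * _ + h 1 (Φ p) * _ + h 2 (Φ p) * _ + h 3 (Φ p) * _ = _
    ring
  ext f p
  obtain ⟨c, hc⟩ := key f p
  rw [hc X]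
  have e3 : (∑ i, X (coordFun Φ i) • coordDer Φ i) f p =
      ∑ i, X (coordFun Φ i) p * coordDer Φ i f p := by
    simp [Fin.sum_univ_four]
  rw [e3]
  refine Finset.sum_congr rfl fun i _ => ?_
  rw [hc (coordDer Φ i)]
  have e4 : ∀ j, (if i = j then (1 : Cinf M) else 0) p = if i = j then 1 else 0 := by
    intro j; split_ifs <;> rfl
  simp [coordDer_coordFun, e4]

end Derivations

/-! ### Lorentzian inner products on a four-dimensional vector space -/

section Eta

variable {R : Type*} [CommRing R]

theorem eta_mul_self (j : Fin 4) : eta R j j * eta R j j = 1 := by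
  fin_cases j <;> simp [eta]

theorem eta_of_ne {i j : Fin 4} (h : i ≠ j) : eta R i j = 0 :=
  Matrix.diagonal_apply_ne _ h

theorem eta_self {i : Fin 4} (h : i ≠ 0) : eta R i i = 1 := by
  fin_cases i <;> simp_all [eta]

end Eta

section Lorentz

variable {V : Type*} [AddCommGroup V] [Module ℝ V] {B : LinearMap.BilinForm ℝ V} {w : Fin 4 → V}

theorem eq_sum_of_orthonormal [FiniteDimensional ℝ V] (hV : Module.finrank ℝ V = 4)
    (hw : ∀ i j, B (w i) (w j) = eta ℝ i j) (x : V) :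
    x = ∑ i, (eta ℝ i i * B x (w i)) • w i := by
  have hcoef : ∀ c : Fin 4 → ℝ, ∀ j, B (∑ i, c i • w i) (w j) = c j * eta ℝ j j := by
    intro c j
    simp only [map_sum, map_smul, LinearMap.sum_apply, LinearMap.smul_apply, hw, smul_eq_mul, eta]
    fin_cases j <;> simp [Fin.sum_univ_four]
  have hli : LinearIndependent ℝ w := by
    rw [Fintype.linearIndependent_iff]
    intro c hc j
    have h := hcoef c j
    rw [hc, map_zero, LinearMap.zero_apply] at h
    calc c j = c j * eta ℝ j j * eta ℝ j j := by rw [mul_assoc, eta_mul_self, mul_one]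
      _ = 0 := by rw [← h, zero_mul]
  have hspan : x ∈ Submodule.span ℝ (Set.range w) := by
    rw [hli.span_eq_top_of_card_eq_finrank' (by simp [hV])]; trivial
  obtain ⟨c, rfl⟩ := (Submodule.mem_span_range_iff_exists_fun ℝ).1 hspan
  refine Finset.sum_congr rfl fun i _ => ?_
  rw [hcoef, mul_comm (c i), ← mul_assoc, eta_mul_self, one_mul]

theorem lorentz_apply [FiniteDimensional ℝ V] (hV : Module.finrank ℝ V = 4)
    (hB : ∀ x y, B x y = B y x)
    (hw : ∀ i j, B (w i) (w j) = eta ℝ i j) (x y : V) :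
    B x y = -(B x (w 0) * B y (w 0)) + (B x (w 1) * B y (w 1) + B x (w 2) * B y (w 2) +
      B x (w 3) * B y (w 3)) := by
  conv_lhs => rw [eq_sum_of_orthonormal hV hw x]
  simp [Fin.sum_univ_four, eta, hB _ y]
  ring

/-- The Cauchy-Schwarz inequality for the spatial parts of timelike vectors. -/
theorem abs_dot_lt_of_timelike {a a₁ a₂ a₃ b b₁ b₂ b₃ : ℝ}
    (ha : -(a * a) + (a₁ * a₁ + a₂ * a₂ + a₃ * a₃) < 0)
    (hb : -(b * b) + (b₁ * b₁ + b₂ * b₂ + b₃ * b₃) < 0) :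
    |a₁ * b₁ + a₂ * b₂ + a₃ * b₃| < |a * b| := by
  rw [← sq_lt_sq]
  have h1 : (a₁ * b₁ + a₂ * b₂ + a₃ * b₃) ^ 2 ≤
      (a₁ * a₁ + a₂ * a₂ + a₃ * a₃) * (b₁ * b₁ + b₂ * b₂ + b₃ * b₃) := by
    nlinarith [sq_nonneg (a₁ * b₂ - a₂ * b₁), sq_nonneg (a₁ * b₃ - a₃ * b₁),
      sq_nonneg (a₂ * b₃ - a₃ * b₂)]
  have h2 : (a₁ * a₁ + a₂ * a₂ + a₃ * a₃) * (b₁ * b₁ + b₂ * b₂ + b₃ * b₃) < (a * a) * (b * b) := by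
    apply mul_lt_mul'' <;> nlinarith [mul_self_nonneg a₁, mul_self_nonneg a₂, mul_self_nonneg a₃,
      mul_self_nonneg b₁, mul_self_nonneg b₂, mul_self_nonneg b₃]
  nlinarith

variable [FiniteDimensional ℝ V]

/-- The sign of the product of two timelike vectors tells whether their time components have the
same sign. -/
theorem timelike_neg_iff (hV : Module.finrank ℝ V = 4) (hB : ∀ x y, B x y = B y x)
    (hw : ∀ i j, B (w i) (w j) = eta ℝ i j) {x y : V} (hx : B x x < 0) (hy : B y y < 0) :
    B x y < 0 ↔ 0 < B x (w 0) * B y (w 0) := by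
  have h := lorentz_apply hV hB hw
  rw [h] at hx hy
  have key := abs_dot_lt_of_timelike hx hy
  rw [h x y]
  rcases abs_cases (B x (w 0) * B y (w 0)) with ⟨e, _⟩ | ⟨e, _⟩ <;>
    · rw [e, abs_lt] at key
      constructor <;> intro <;> linarith [key.1, key.2]

theorem timelike_ne_zero (hV : Module.finrank ℝ V = 4) (hB : ∀ x y, B x y = B y x)
    (hw : ∀ i j, B (w i) (w j) = eta ℝ i j) {x y : V} (hx : B x x < 0) (hy : B y y < 0) :
    B x y ≠ 0 := by
  intro h0
  have h := lorentz_apply hV hB hw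
  rw [h] at hx hy h0
  have key := abs_dot_lt_of_timelike hx hy
  rw [show B x (w 1) * B y (w 1) + B x (w 2) * B y (w 2) + B x (w 3) * B y (w 3) =
    B x (w 0) * B y (w 0) by linarith] at key
  exact lt_irrefl _ key

theorem mul_pos_iff_of_ne_zero {a b c : ℝ} (ha : a ≠ 0) (hb : b ≠ 0) (hc : c ≠ 0) :
    0 < a * c ↔ (0 < a * b ↔ 0 < b * c) := by
  rcases lt_or_gt_of_ne ha with h1 | h1 <;> rcases lt_or_gt_of_ne hb with h2 | h2 <;>
    rcases lt_or_gt_of_ne hc with h3 | h3 <;>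
    simp [mul_pos_iff, h1, h2, h3, h1.not_gt, h2.not_gt, h3.not_gt]

/-- Lying in the same half of the light cone is a transitive relation, and there are only two
halves. -/
theorem timelike_trans (hV : Module.finrank ℝ V = 4) (hB : ∀ x y, B x y = B y x)
    (hw : ∀ i j, B (w i) (w j) = eta ℝ i j) {x y z : V} (hx : B x x < 0) (hy : B y y < 0)
    (hz : B z z < 0) : B x z < 0 ↔ (B x y < 0 ↔ B y z < 0) := by
  have hne : ∀ {u : V}, B u u < 0 → B u (w 0) ≠ 0 := by
    intro u hu h0
    have h := (timelike_neg_iff hV hB hw hu hu).1 hu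
    simp [h0] at h
  rw [timelike_neg_iff hV hB hw hx hz, timelike_neg_iff hV hB hw hx hy,
    timelike_neg_iff hV hB hw hy hz]
  exact mul_pos_iff_of_ne_zero (hne hx) (hne hy) (hne hz)

/-- The form is positive definite on the orthogonal complement of a timelike vector. -/
theorem spacelike_of_orthogonal (hV : Module.finrank ℝ V = 4) (hB : ∀ x y, B x y = B y x)
    (hw : ∀ i j, B (w i) (w j) = eta ℝ i j) {x y : V} (hx : B x x < 0) (hxy : B x y = 0)
    (hy : y ≠ 0) : 0 < B y y := by
  by_contra hneg
  have hneg' : B y y ≤ 0 := not_lt.1 hneg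
  have h := lorentz_apply hV hB hw
  rcases hneg'.lt_or_eq with hlt | heq
  · exact timelike_ne_zero hV hB hw hx hlt hxy
  · apply hy
    rw [h] at hx heq hxy
    rw [eq_sum_of_orthonormal hV hw y]
    generalize B x (w 0) = a at *
    generalize B x (w 1) = a₁ at *
    generalize B x (w 2) = a₂ at *
    generalize B x (w 3) = a₃ at *
    -- If `y` is not spacelike, then Cauchy-Schwarz for the spatial parts shows that its time
    -- component vanishes; then so do its spatial components.
    have h0 : B y (w 0) = 0 := by
      by_contra hb
      have hb' := mul_self_pos.2 hb
      generalize B y (w 0) = b at *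
      generalize B y (w 1) = b₁ at *
      generalize B y (w 2) = b₂ at *
      generalize B y (w 3) = b₃ at *
      have h1 : (a₁ * b₁ + a₂ * b₂ + a₃ * b₃) ^ 2 ≤
          (a₁ * a₁ + a₂ * a₂ + a₃ * a₃) * (b₁ * b₁ + b₂ * b₂ + b₃ * b₃) := by
        nlinarith [sq_nonneg (a₁ * b₂ - a₂ * b₁), sq_nonneg (a₁ * b₃ - a₃ * b₁),
          sq_nonneg (a₂ * b₃ - a₃ * b₂)]
      rw [show a₁ * b₁ + a₂ * b₂ + a₃ * b₃ = a * b by linarith,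
        show b₁ * b₁ + b₂ * b₂ + b₃ * b₃ = b * b by linarith] at h1
      nlinarith
    rw [h0] at heq
    have h1 : B y (w 1) = 0 := by
      nlinarith [mul_self_nonneg (B y (w 1)), mul_self_nonneg (B y (w 2)),
        mul_self_nonneg (B y (w 3))]
    have h2 : B y (w 2) = 0 := by
      nlinarith [mul_self_nonneg (B y (w 1)), mul_self_nonneg (B y (w 2)),
        mul_self_nonneg (B y (w 3))]
    have h3 : B y (w 3) = 0 := by
      nlinarith [mul_self_nonneg (B y (w 1)), mul_self_nonneg (B y (w 2)),
        mul_self_nonneg (B y (w 3))]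
    simp [Fin.sum_univ_four, h0, h1, h2, h3]

end Lorentz

/-! ### Time orientations -/

section TimeOrientation
open Filter Topology

variable {X : Type*} [TopologicalSpace X] {V : Type*} [AddCommGroup V] [Module ℝ V]
  [FiniteDimensional ℝ V]

open Classical in
/-- The double covering of `X` whose fibre at `p` consists of the two halves of the light cone of
`G p`, as a fibre bundle with fibre `Bool`. The chart indexed by `x : X` labels with `true` the half
that contains the vector `t x`. -/
def coneCore (hV : Module.finrank ℝ V = 4) (G : X → LinearMap.BilinForm ℝ V)
    (hG : ∀ c d, Continuous fun p => G p c d)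
    (hsymm : ∀ p c d, G p c d = G p d c)
    (hsig : ∀ p, ∃ w : Fin 4 → V, ∀ i j, G p (w i) (w j) = eta ℝ i j)
    (t : X → V) (ht : ∀ p, G p (t p) (t p) < 0) : FiberBundleCore X X Bool where
  baseSet x := {p | G p (t x) (t x) < 0}
  isOpen_baseSet x := isOpen_lt (hG _ _) continuous_const
  indexAt x := x
  mem_baseSet_at x := ht x
  coordChange x y p b := if G p (t x) (t y) < 0 then b else !b
  coordChange_self x p hp b := if_pos hp
  continuousOn_coordChange x y := by
    rintro ⟨p, b⟩ ⟨⟨hx, hy⟩, -⟩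
    obtain ⟨w, hw⟩ := hsig p
    have hne : G p (t x) (t y) ≠ 0 := timelike_ne_zero hV (hsymm p) hw hx hy
    refine ContinuousAt.continuousWithinAt ?_
    have hc : ContinuousAt (fun q : X × Bool => G q.1 (t x) (t y)) (p, b) :=
      ((hG _ _).comp continuous_fst).continuousAt
    rcases lt_or_gt_of_ne hne with h | h
    · refine (continuous_snd.continuousAt (x := (p, b))).congr ?_
      filter_upwards [hc.eventually_lt_const h] with q hq
      exact (if_pos hq).symm
    · refine ((continuous_of_discreteTopology (f := not)).comp
        continuous_snd).continuousAt.congr ?_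
      filter_upwards [hc.eventually_const_lt h] with q hq
      exact (if_neg (not_lt.2 hq.le)).symm
  coordChange_comp x y z p hp b := by
    obtain ⟨w, hw⟩ := hsig p
    have := timelike_trans hV (hsymm p) hw hp.1.1 hp.1.2 hp.2
    by_cases h1 : G p (t x) (t y) < 0 <;> by_cases h2 : G p (t y) (t z) < 0 <;>
      simp only [h1, h2, iff_true, iff_false, not_true] at this <;> simp [h1, h2, this]

/-- A simply connected family of Lorentzian inner products is time orientable: one half of the
light cone can be chosen continuously, by a section of the double covering by such halves. The
set `O p` of timelike vectors in the chosen half is convex and contains locally constant vectors. -/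
theorem exists_timeOrientation [SimplyConnectedSpace X] [LocallyPathConnectedSpace X]
    (hV : Module.finrank ℝ V = 4) (G : X → LinearMap.BilinForm ℝ V)
    (hG : ∀ c d, Continuous fun p => G p c d)
    (hsymm : ∀ p c d, G p c d = G p d c)
    (hsig : ∀ p, ∃ w : Fin 4 → V, ∀ i j, G p (w i) (w j) = eta ℝ i j) :
    ∃ O : X → Set V, (∀ p, Convex ℝ (O p)) ∧ (∀ p, ∀ c ∈ O p, G p c c < 0) ∧
      ∀ x, ∃ c, ∀ᶠ p in 𝓝 x, c ∈ O p := by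
  classical
  have ht : ∀ p, ∃ c, G p c c < 0 := fun p => by
    obtain ⟨w, hw⟩ := hsig p
    exact ⟨w 0, by simp [hw, eta]⟩
  choose t ht using ht
  let Z := coneCore hV G hG hsymm hsig t ht
  have hcov : IsCoveringMap (Bundle.TotalSpace.proj : Bundle.TotalSpace Bool Z.Fiber → X) :=
    FiberBundle.isCoveringMap
  obtain ⟨x₀⟩ : Nonempty X := inferInstance
  obtain ⟨s, ⟨-, hs⟩, -⟩ := hcov.existsUnique_continuousMap_lifts (ContinuousMap.id X) x₀
    ⟨x₀, (true : Bool)⟩ rfl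
  have hproj : ∀ p, (s p).1 = p := fun p => congrFun hs p
  -- The label of the chosen half of the cone at `p` in the chart indexed by `x`.
  let lab : X → X → Bool := fun x p => ((Z.localTriv x) (s p)).2
  have hlab : ∀ x p, lab x p = if G p (t p) (t x) < 0 then lab p p else !(lab p p) := by
    have h1 : ∀ p, ∃ b : Bool, ∀ x, lab x p = if G p (t p) (t x) < 0 then b else !b := by
      intro p
      refine ⟨(s p).2, fun x => ?_⟩
      change Z.coordChange (Z.indexAt (s p).1) x (s p).1 (s p).2 = _
      rw [hproj]; rfl
    intro x p
    obtain ⟨b, hb⟩ := h1 p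
    rw [hb x, hb p, if_pos (ht p)]
  have hcont : ∀ x, ∀ᶠ p in 𝓝 x, lab x p = lab x x := by
    intro x
    have hmem : s x ∈ (Z.localTriv x).source := by
      rw [Z.mem_localTriv_source]
      change (s x).1 ∈ Z.baseSet x
      rw [hproj]; exact ht x
    have : ContinuousAt (lab x) x :=
      (((Z.localTriv x).continuousOn_toFun.continuousAt
        ((Z.localTriv x).open_source.mem_nhds hmem)).comp s.continuous.continuousAt).snd
    exact this.eventually (p := fun b => b = lab x x) (by simp [nhds_discrete])
  -- Timelike vectors in the same half of the light cone have negative product.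
  have key : ∀ p (b : Bool) {c d : V}, (G p c c < 0 ∧ decide (G p (t p) c < 0) = b) →
      (G p d d < 0 ∧ decide (G p (t p) d < 0) = b) → G p c d < 0 := by
    rintro p b c d ⟨hc, hc'⟩ ⟨hd, hd'⟩
    obtain ⟨w, hw⟩ := hsig p
    rw [timelike_trans hV (hsymm p) hw hc (ht p) hd, hsymm p c, ← decide_eq_decide, hc', hd']
  refine ⟨fun p => {c | G p c c < 0 ∧ decide (G p (t p) c < 0) = lab p p}, fun p => ?_,
    fun p c hc => hc.1, fun x => ?_⟩
  · rw [convex_iff_forall_pos]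
    rintro c hc d hd a b ha hb -
    have hcd := key p _ hc hd
    have hneg : G p (a • c + b • d) (a • c + b • d) < 0 := by
      simp only [map_add, map_smul, LinearMap.add_apply, LinearMap.smul_apply, smul_eq_mul,
        hsymm p d c]
      have h1 := mul_neg_of_pos_of_neg (mul_pos ha ha) hc.1
      have h2 := mul_neg_of_pos_of_neg (mul_pos hb hb) hd.1
      have h3 := mul_neg_of_pos_of_neg (mul_pos ha hb) hcd
      linarith
    refine ⟨hneg, ?_⟩
    obtain ⟨w, hw⟩ := hsig p
    rw [← hc.2, decide_eq_decide, timelike_trans hV (hsymm p) hw (ht p) hc.1 hneg]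
    have h4 : G p c (a • c + b • d) < 0 := by
      simp only [map_add, map_smul, smul_eq_mul]
      have h1 := mul_neg_of_pos_of_neg ha hc.1
      have h2 := mul_neg_of_pos_of_neg hb hcd
      linarith
    simp only [h4, iff_true]
  · refine ⟨if lab x x then t x else -t x, ?_⟩
    filter_upwards [hcont x, (hG (t x) (t x)).continuousAt.eventually_lt_const (ht x)] with p h1 h2
    obtain ⟨w, hw⟩ := hsig p
    have hne := timelike_ne_zero hV (hsymm p) hw (ht p) h2
    rw [hlab] at h1
    rw [← h1]
    rcases lt_or_gt_of_ne hne with h | h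
    · cases h3 : lab p p <;> simp [h, h2, h.le]
    · cases h3 : lab p p <;> simp [h, h2, h.not_gt]

end TimeOrientation

/-! ### Orthonormal frames -/

section Frames
open Filter Topology

variable {M : Type*} [TopologicalSpace M] [ChartedSpace (EuclideanSpace ℝ (Fin 4)) M]
  {W : Type*} [AddCommGroup W] [Module (Cinf M) W]

/-- The value at a point of an element of `W`, in the coordinates given by a basis. -/
def fibreVal (e : Module.Basis (Fin 4) (Cinf M) W) (p : M) : W →+ (Fin 4 → ℝ) where
  toFun w i := e.repr w i p
  map_zero' := by ext i; simp
  map_add' v w := by ext i; simp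

theorem fibreVal_smul (e : Module.Basis (Fin 4) (Cinf M) W) (p : M) (f : Cinf M) (w : W) :
    fibreVal e p (f • w) = f p • fibreVal e p w := by
  ext i
  simp [fibreVal]

theorem eq_zero_of_fibreVal (e : Module.Basis (Fin 4) (Cinf M) W) {w : W}
    (h : ∀ p, fibreVal e p w = 0) : w = 0 := by
  refine e.ext_elem fun i => ?_
  ext p
  rw [map_zero]
  exact congrFun (h p) i

theorem fibreVal_sum (e : Module.Basis (Fin 4) (Cinf M) W) (p : M) (f : Fin 4 → Cinf M) :
    fibreVal e p (∑ i, f i • e i) = fun i => f i p := by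
  ext i
  change e.repr (∑ i, f i • e i) i p = _
  rw [e.repr_sum_self]

/-- The bilinear form on the fibre at a point, in the coordinates given by a basis. -/
def fibreForm (e : Module.Basis (Fin 4) (Cinf M) W) (g : LinearMap.BilinForm (Cinf M) W) (p : M) :
    LinearMap.BilinForm ℝ (Fin 4 → ℝ) :=
  Matrix.toBilin' (Matrix.of fun i j => g (e i) (e j) p)

theorem fibreForm_apply (e : Module.Basis (Fin 4) (Cinf M) W) (g : LinearMap.BilinForm (Cinf M) W)
    (p : M) (c d : Fin 4 → ℝ) :
    fibreForm e g p c d = ∑ i, ∑ j, c i * g (e i) (e j) p * d j := by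
  simp [fibreForm, Matrix.toBilin'_apply]

theorem fibreForm_fibreVal (e : Module.Basis (Fin 4) (Cinf M) W)
    (g : LinearMap.BilinForm (Cinf M) W) (p : M) (v w : W) :
    fibreForm e g p (fibreVal e p v) (fibreVal e p w) = g v w p := by
  have h : g v w = ∑ i, ∑ j, e.repr v i * g (e i) (e j) * e.repr w j := by
    conv_lhs => rw [← e.sum_repr v, ← e.sum_repr w]
    simp only [map_sum, map_smul, LinearMap.sum_apply, LinearMap.smul_apply, smul_eq_mul,
      Finset.mul_sum]
    rw [Finset.sum_comm]
    exact Finset.sum_congr rfl fun i _ => Finset.sum_congr rfl fun j _ => by ring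
  rw [h, fibreForm_apply]
  simp [Fin.sum_univ_four, fibreVal]

theorem continuous_fibreForm (e : Module.Basis (Fin 4) (Cinf M) W)
    (g : LinearMap.BilinForm (Cinf M) W) (c d : Fin 4 → ℝ) :
    Continuous fun p => fibreForm e g p c d := by
  simp only [fibreForm_apply]
  refine continuous_finsetSum _ fun i _ => continuous_finsetSum _ fun j _ => ?_
  exact (continuous_const.mul (g (e i) (e j)).contMDiff.continuous).mul continuous_const

variable {g : LinearMap.BilinForm (Cinf M) W}

theorem IsLorentzian.fibreForm_symm (hg : IsLorentzian g) (e : Module.Basis (Fin 4) (Cinf M) W)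
    (p : M) (c d : Fin 4 → ℝ) : fibreForm e g p c d = fibreForm e g p d c := by
  simp only [fibreForm_apply]
  rw [Finset.sum_comm]
  refine Finset.sum_congr rfl fun i _ => Finset.sum_congr rfl fun j _ => ?_
  rw [hg.symm]; ring

theorem IsLorentzian.exists_fibre_orthonormal (hg : IsLorentzian g)
    (e : Module.Basis (Fin 4) (Cinf M) W) (p : M) :
    ∃ w : Fin 4 → (Fin 4 → ℝ), ∀ i j, fibreForm e g p (w i) (w j) = eta ℝ i j := by
  obtain ⟨w, hw⟩ := hg.signature p
  exact ⟨fun i => fibreVal e p (w i), fun i j => by rw [fibreForm_fibreVal, hw]⟩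

/-- The halves of the light cones chosen by a time orientation are convex, so that a partition of
unity glues local timelike sections to a global one. -/
theorem IsLorentzian.exists_timelike [IsManifold (𝓡 4) ∞ M] [SimplyConnectedSpace M]
    [LocallyPathConnectedSpace M] [SigmaCompactSpace M] [T2Space M] (hg : IsLorentzian g)
    (e : Module.Basis (Fin 4) (Cinf M) W) : ∃ v : W, ∀ p, g v v p < 0 := by
  obtain ⟨O, hO, hneg, hloc⟩ := exists_timeOrientation (by simp) (fibreForm e g)
    (continuous_fibreForm e g) (hg.fibreForm_symm e) (hg.exists_fibre_orthonormal e)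
  obtain ⟨c, hc⟩ := exists_contMDiffMap_forall_mem_convex_of_local_const (𝓡 4) (n := ⊤) hO hloc
  have hsm : ∀ i, ContMDiff (𝓡 4) 𝓘(ℝ, ℝ) ∞ fun p => c p i :=
    fun i => contMDiff_pi_space.1 c.contMDiff i
  let f : Fin 4 → Cinf M := fun i => ⟨fun p => c p i, hsm i⟩
  refine ⟨∑ i, f i • e i, fun p => ?_⟩
  rw [← fibreForm_fibreVal e, fibreVal_sum]
  exact hneg p _ (hc p)

theorem exists_sqrt_inv {f : Cinf M} (hf : ∀ p, 0 < f p) : ∃ s : Cinf M, s * s * f = 1 := by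
  refine ⟨⟨fun p => (√(f p))⁻¹, fun p => ?_⟩, ?_⟩
  · exact (((Real.contDiffAt_sqrt (hf p).ne').contMDiffAt.comp p f.contMDiff.contMDiffAt)).inv₀
      (Real.sqrt_pos.2 (hf p)).ne'
  · ext p
    change (√(f p))⁻¹ * (√(f p))⁻¹ * f p = 1
    rw [← mul_inv, Real.mul_self_sqrt (hf p).le, inv_mul_cancel₀ (hf p).ne']

/-- The matrix of right multiplication by a quaternion; its rows complete the quaternion to an
orthogonal frame. -/
def quatMatrix {R : Type*} [CommRing R] (f : Fin 4 → R) : Matrix (Fin 4) (Fin 4) R :=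
  !![f 0, f 1, f 2, f 3; -f 1, f 0, -f 3, f 2; -f 2, f 3, f 0, -f 1; -f 3, -f 2, f 1, f 0]

theorem linearIndependent_quatMatrix {n : Fin 4 → ℝ} (hn : n ≠ 0) :
    LinearIndependent ℝ fun k => quatMatrix n k := by
  rw [Fintype.linearIndependent_iff]
  intro c hc
  have h0 := congrFun hc 0
  have h1 := congrFun hc 1
  have h2 := congrFun hc 2
  have h3 := congrFun hc 3
  simp [Fin.sum_univ_four, quatMatrix] at h0 h1 h2 h3
  have hN : n 0 * n 0 + n 1 * n 1 + n 2 * n 2 + n 3 * n 3 ≠ 0 := by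
    intro h
    apply hn
    ext i
    fin_cases i <;> simp <;> nlinarith [mul_self_nonneg (n 0), mul_self_nonneg (n 1),
      mul_self_nonneg (n 2), mul_self_nonneg (n 3)]
  intro i
  suffices (n 0 * n 0 + n 1 * n 1 + n 2 * n 2 + n 3 * n 3) * c i = 0 from
    (mul_eq_zero.1 this).resolve_left hN
  match i with
  | 0 => linear_combination n 0 * h0 + n 1 * h1 + n 2 * h2 + n 3 * h3
  | 1 => linear_combination -n 1 * h0 + n 0 * h1 - n 3 * h2 + n 2 * h3
  | 2 => linear_combination -n 2 * h0 + n 3 * h1 + n 0 * h2 - n 1 * h3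
  | 3 => linear_combination -n 3 * h0 - n 2 * h1 + n 1 * h2 + n 0 * h3

/-- Every nowhere vanishing element of `W` is the first vector of a frame: complete it by its
products with the imaginary quaternions. -/
theorem exists_frame (e : Module.Basis (Fin 4) (Cinf M) W) (v : W)
    (hv : ∀ p, fibreVal e p v ≠ 0) :
    ∃ V : Fin 4 → W, V 0 = v ∧ ∀ p, LinearIndependent ℝ fun k => fibreVal e p (V k) := by
  refine ⟨fun k => ∑ i, quatMatrix (e.repr v) k i • e i, ?_, fun p => ?_⟩
  · refine Eq.trans ?_ (e.sum_repr v)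
    exact Finset.sum_congr rfl fun i _ => by fin_cases i <;> rfl
  · convert linearIndependent_quatMatrix (hv p) using 2 with k
    rw [fibreVal_sum]
    ext i
    fin_cases k <;> fin_cases i <;> simp [quatMatrix, fibreVal]

/-- The Gram-Schmidt process: once the timelike vector comes first, all subsequent norms are
positive, so that they have smooth square roots. -/
theorem IsLorentzian.gramSchmidt (hg : IsLorentzian g) (e : Module.Basis (Fin 4) (Cinf M) W)
    (V : Fin 4 → W) (hV0 : ∀ p, g (V 0) (V 0) p < 0)
    (hV : ∀ p, LinearIndependent ℝ fun k => fibreVal e p (V k)) (k : ℕ) (hk : k < 4) :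
    ∃ T : Fin 4 → W, (∀ i j : Fin 4, i.val ≤ k → j.val ≤ k → g (T i) (T j) = eta (Cinf M) i j) ∧
      ∀ p, ∀ i : Fin 4, i.val ≤ k → fibreVal e p (T i) ∈
        Submodule.span ℝ ((fun j => fibreVal e p (V j)) '' {j | j.val ≤ k}) := by
  induction k with
  | zero =>
    obtain ⟨s, hs⟩ := exists_sqrt_inv (f := -g (V 0) (V 0)) fun p => by
      have := hV0 p
      simpa using this
    refine ⟨fun _ => s • V 0, fun i j hi hj => ?_, fun p i hi => ?_⟩
    · obtain rfl : i = 0 := Fin.ext (by simpa using hi)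
      obtain rfl : j = 0 := Fin.ext (by simpa using hj)
      simp only [map_smul, LinearMap.smul_apply, smul_eq_mul, eta, Matrix.diagonal_apply_eq,
        Matrix.cons_val_zero]
      linear_combination -hs
    · rw [fibreVal_smul]
      exact Submodule.smul_mem _ _ (Submodule.subset_span ⟨0, by simp, rfl⟩)
  | succ k ih =>
    obtain ⟨T, hT, hspan⟩ := ih (by omega)
    set a : Fin 4 := ⟨k + 1, hk⟩ with ha
    set U : W := V a - ∑ i ∈ Finset.univ.filter (fun i : Fin 4 => i.val ≤ k),
      (eta (Cinf M) i i * g (V a) (T i)) • T i with hU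
    have hUT : ∀ j : Fin 4, j.val ≤ k → g U (T j) = 0 := by
      intro j hj
      rw [hU, map_sub, LinearMap.sub_apply, map_sum, LinearMap.sum_apply,
        Finset.sum_eq_single_of_mem j (by simpa using hj)]
      · simp only [map_smul, LinearMap.smul_apply, smul_eq_mul, hT j j hj hj]
        linear_combination -g (V a) (T j) * eta_mul_self (R := Cinf M) j
      · intro i hi hij
        simp only [map_smul, LinearMap.smul_apply, smul_eq_mul,
          hT i j (by simpa using hi) hj, eta_of_ne hij, mul_zero]
    have hVa : ∀ p, fibreVal e p (V a) - fibreVal e p U ∈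
        Submodule.span ℝ ((fun j => fibreVal e p (V j)) '' {j | j.val ≤ k}) := by
      intro p
      rw [hU, map_sub, sub_sub_cancel, map_sum]
      refine Submodule.sum_mem _ fun i hi => ?_
      rw [fibreVal_smul]
      exact Submodule.smul_mem _ _ (hspan p i (by simpa using hi))
    have hU0 : ∀ p, fibreVal e p U ≠ 0 := by
      intro p h0
      have h1 := hVa p
      rw [h0, sub_zero] at h1
      exact (hV p).notMem_span_image (s := {j | j.val ≤ k}) (x := a) (by simp [ha]) h1
    have hpos : ∀ p, 0 < g U U p := by
      intro p
      obtain ⟨w, hw⟩ := hg.exists_fibre_orthonormal e p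
      rw [← fibreForm_fibreVal e]
      refine spacelike_of_orthogonal (by simp) (hg.fibreForm_symm e p) hw
        (x := fibreVal e p (T 0)) ?_ ?_ (hU0 p)
      · rw [fibreForm_fibreVal, hT 0 0 (by simp) (by simp)]
        simp [eta]
      · rw [fibreForm_fibreVal, hg.symm, hUT 0 (by simp)]
        simp
    clear_value U
    obtain ⟨s, hs⟩ := exists_sqrt_inv hpos
    have hmono : ∀ p, Submodule.span ℝ ((fun j => fibreVal e p (V j)) '' {j | j.val ≤ k}) ≤
        Submodule.span ℝ ((fun j => fibreVal e p (V j)) '' {j | j.val ≤ k + 1}) := fun p =>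
      Submodule.span_mono (Set.image_mono fun j (hj : j.val ≤ k) => Nat.le_succ_of_le hj)
    have hlast : ∀ i : Fin 4, i.val ≤ k + 1 → i ≠ a → i.val ≤ k := fun i hi hia =>
      Nat.lt_succ_iff.1 (lt_of_le_of_ne hi fun h => hia (Fin.ext h))
    refine ⟨Function.update T a (s • U), fun i j hi hj => ?_, fun p i hi => ?_⟩
    · have hia := hlast i hi
      have hja := hlast j hj
      by_cases h1 : i = a <;> by_cases h2 : j = a
      · subst h1; subst h2
        have : eta (Cinf M) a a = 1 := eta_self fun h => by simpa [ha] using congrArg Fin.val h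
        simp only [Function.update_self, map_smul, LinearMap.smul_apply, smul_eq_mul, this]
        linear_combination hs
      · subst h1
        rw [Function.update_self, Function.update_of_ne h2, map_smul, LinearMap.smul_apply,
          hUT j (hja h2), smul_zero, eta_of_ne (Ne.symm h2)]
      · subst h2
        rw [Function.update_self, Function.update_of_ne h1, map_smul, hg.symm,
          hUT i (hia h1), smul_zero, eta_of_ne h1]
      · rw [Function.update_of_ne h1, Function.update_of_ne h2, hT i j (hia h1) (hja h2)]
    · by_cases h1 : i = a
      · subst h1
        rw [Function.update_self, fibreVal_smul]
        refine Submodule.smul_mem _ _ ?_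
        have h := hmono p (hVa p)
        rw [← Submodule.neg_mem_iff, neg_sub] at h
        have h' : fibreVal e p (V a) ∈
            Submodule.span ℝ ((fun j => fibreVal e p (V j)) '' {j | j.val ≤ k + 1}) :=
          Submodule.subset_span ⟨a, by simp [ha], rfl⟩
        simpa using Submodule.add_mem _ h h'
      · rw [Function.update_of_ne h1]
        exact hmono p (hspan p i (hlast i hi h1))

/-- On a simply connected manifold a Lorentzian form has a global orthonormal frame: complete a
global timelike vector to a frame and orthonormalize it. -/
theorem IsLorentzian.exists_orthonormal_basis [IsManifold (𝓡 4) ∞ M] [SimplyConnectedSpace M]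
    [LocallyPathConnectedSpace M] [SigmaCompactSpace M] [T2Space M] (hg : IsLorentzian g)
    (e : Module.Basis (Fin 4) (Cinf M) W) :
    ∃ θ : Module.Basis (Fin 4) (Cinf M) W, ∀ i j, g (θ i) (θ j) = eta (Cinf M) i j := by
  obtain ⟨v, hv⟩ := hg.exists_timelike e
  obtain ⟨V, rfl, hV⟩ := exists_frame e v fun p h0 => by
    have := hv p
    rw [← fibreForm_fibreVal e, h0] at this
    simp at this
  obtain ⟨T, hT, -⟩ := hg.gramSchmidt e V hv hV 3 (by omega)
  replace hT : ∀ i j, g (T i) (T j) = eta (Cinf M) i j :=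
    fun i j => hT i j (by omega) (by omega)
  have hcoef : ∀ c : Fin 4 → Cinf M, ∀ j, g (∑ i, c i • T i) (T j) = c j * eta (Cinf M) j j := by
    intro c j
    simp only [map_sum, map_smul, LinearMap.sum_apply, LinearMap.smul_apply, hT, smul_eq_mul, eta]
    fin_cases j <;> simp [Fin.sum_univ_four]
  have hli : LinearIndependent (Cinf M) T := by
    rw [Fintype.linearIndependent_iff]
    intro c hc j
    have h := hcoef c j
    rw [hc, map_zero, LinearMap.zero_apply] at h
    calc c j = c j * eta (Cinf M) j j * eta (Cinf M) j j := by rw [mul_assoc, eta_mul_self, mul_one]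
      _ = 0 := by rw [← h, zero_mul]
  have hexp : ∀ x, x = ∑ i, (eta (Cinf M) i i * g x (T i)) • T i := by
    intro x
    refine sub_eq_zero.1 (eq_zero_of_fibreVal e fun p => ?_)
    have hw : ∀ i j, fibreForm e g p (fibreVal e p (T i)) (fibreVal e p (T j)) = eta ℝ i j := by
      intro i j
      rw [fibreForm_fibreVal, hT]
      fin_cases i <;> fin_cases j <;> simp [eta]
    rw [map_sub, sub_eq_zero, map_sum]
    conv_lhs => rw [eq_sum_of_orthonormal (by simp) hw (fibreVal e p x)]
    refine Finset.sum_congr rfl fun i _ => ?_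
    rw [fibreVal_smul, fibreForm_fibreVal]
    congr 1
    fin_cases i <;> simp [eta]
  refine ⟨Module.Basis.mk hli fun x _ => ?_, fun i j => by simp [hT]⟩
  rw [hexp x]
  exact Submodule.sum_mem _ fun i _ => Submodule.smul_mem _ _ (Submodule.subset_span ⟨i, rfl⟩)

end Frames

/-! ### Bases and base change -/

section BaseChange

/-- If an `R`-linear map sends an `R`-basis of `X` to an `S`-basis of `Y`, then its `S`-linear
extension `S ⊗ X → Y` is an isomorphism. -/
theorem exists_baseChange_equiv {R S X Y ι : Type*} [CommRing R] [Ring S] [Algebra R S]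
    [AddCommGroup X] [Module R X] [AddCommGroup Y] [Module R Y] [Module S Y] [IsScalarTower R S Y]
    (x : Module.Basis ι R X) (y : Module.Basis ι S Y) (φ : X →ₗ[R] Y) (h : ∀ i, y i = φ (x i)) :
    ∃ e : (S ⊗[R] X) ≃ₗ[S] Y, ∀ u a, e (u ⊗ₜ[R] a) = u • φ a := by
  refine ⟨(Algebra.TensorProduct.basis S x).equiv y (Equiv.refl ι), fun u a => ?_⟩
  rw [show u ⊗ₜ[R] a = u • ((1 : S) ⊗ₜ[R] a) by rw [TensorProduct.smul_tmul', smul_eq_mul, mul_one],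
    map_smul]
  congr 1
  have : (((Algebra.TensorProduct.basis S x).equiv y (Equiv.refl ι)).toLinearMap.restrictScalars R)
      ∘ₗ TensorProduct.mk R S X 1 = φ := by
    refine x.ext fun i => ?_
    rw [← h]
    have := (Algebra.TensorProduct.basis S x).equiv_apply i y (Equiv.refl ι)
    rw [Algebra.TensorProduct.basis_apply] at this
    exact this
  exact LinearMap.congr_fun this a

/-- A block triangular change of a basis, with units on the diagonal of the second block. -/
theorem exists_basis_triangular {S L ι κ : Type*} [Ring S] [AddCommGroup L] [Module S L]
    (b : Module.Basis (ι ⊕ κ) S L) (u : κ → Sˣ) (r : κ → L)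
    (hr : ∀ j, r j ∈ Submodule.span S (Set.range fun i => b (Sum.inl i))) :
    ∃ c : Module.Basis (ι ⊕ κ) S L, (∀ i, c (Sum.inl i) = b (Sum.inl i)) ∧
      ∀ j, c (Sum.inr j) = (u j : S) • b (Sum.inr j) + r j := by
  let b' := b.unitsSMul (Sum.elim (fun _ => 1) u)
  have hl : ∀ i, b' (Sum.inl i) = b (Sum.inl i) := fun i => by
    simp [b', Module.Basis.unitsSMul_apply]
  have hb' : ∀ j, b' (Sum.inr j) = (u j : S) • b (Sum.inr j) := fun j => by
    simp [b', Module.Basis.unitsSMul_apply, Units.smul_def]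
  -- Change the rescaled basis `b'` by the unipotent map `1 + N`, where `N² = 0`.
  let N : L →ₗ[S] L := b'.constr ℕ (Sum.elim (fun _ => 0) r)
  have hN : ∀ i, N (b (Sum.inl i)) = 0 := fun i => by
    rw [← hl]; simp [N, Module.Basis.constr_basis]
  have hN' : ∀ j, N (b' (Sum.inr j)) = r j := fun j => by
    simp [N, Module.Basis.constr_basis]
  have hr0 : ∀ j, N (r j) = 0 := by
    intro j
    have : Submodule.span S (Set.range fun i => b (Sum.inl i)) ≤ LinearMap.ker N := by
      rw [Submodule.span_le]
      rintro _ ⟨i, rfl⟩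
      exact hN i
    exact this (hr j)
  have hNN : ∀ x, N (N x) = 0 := by
    intro x
    have : N ∘ₗ N = 0 := by
      refine b'.ext ?_
      rintro (i | j)
      · simp [hl, hN]
      · simp [hN', hr0]
    exact LinearMap.congr_fun this x
  let e : L ≃ₗ[S] L := LinearEquiv.ofLinearMap (LinearMap.id + N) (LinearMap.id - N)
    (by ext x; simp [hNN]) (by ext x; simp [hNN])
  refine ⟨b'.map e, fun i => ?_, fun j => ?_⟩
  · simp [e, hl, hN]
  · change b' (Sum.inr j) + N (b' (Sum.inr j)) = _
    rw [hN', hb']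

end BaseChange

theorem eq_zero_of_add_self_eq_zero {R N : Type*} [CommRing R] [Algebra ℝ R] [AddCommGroup N]
    [Module R N] {x : N} (h : x + x = 0) : x = 0 := by
  have h1 : algebraMap ℝ R (1 / 2) • (x + x) = x := by
    rw [← two_smul R x, smul_smul, ← map_ofNat (algebraMap ℝ R) 2, ← map_mul]
    norm_num
  rw [← h1, h, smul_zero]

/-! ### Parity in Clifford modules -/

section CliffordGeneral

variable {R : Type*} [CommRing R]
  {W : Type*} [AddCommGroup W] [Module R W]
  {g : LinearMap.BilinForm R W}

/-- The Clifford algebra is isomorphic, as a module, to the exterior algebra, which contains the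
scalars. -/
theorem algebraMap_cl_injective (g : LinearMap.BilinForm R W) :
    Function.Injective (algebraMap R (Cl g)) := by
  have h : g.toQuadraticMap = 0 - -(LinearMap.BilinMap.toQuadraticMap g) := by simp
  intro a b hab
  have h2 := congrArg (CliffordAlgebra.changeForm h) hab
  rw [CliffordAlgebra.changeForm_algebraMap, CliffordAlgebra.changeForm_algebraMap] at h2
  exact ExteriorAlgebra.algebraMap_leftInverse W |>.injective h2

theorem tmul_mem_clTensor {X : Type*} [AddCommMonoid X] [Module R X] {S : Submodule R (Cl g)}
    {u : Cl g} (hu : u ∈ S) (x : X) : u ⊗ₜ[R] x ∈ clTensor S X :=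
  ⟨(⟨u, hu⟩ : S) ⊗ₜ[R] x, by simp⟩

theorem clTensor_induction {X : Type*} [AddCommMonoid X] [Module R X] {S : Submodule R (Cl g)}
    {p : Cl g ⊗[R] X → Prop} (h0 : p 0) (ht : ∀ u ∈ S, ∀ x, p (u ⊗ₜ[R] x))
    (ha : ∀ y z, p y → p z → p (y + z)) {y : Cl g ⊗[R] X} (hy : y ∈ clTensor S X) : p y := by
  obtain ⟨z, rfl⟩ := hy
  induction z using TensorProduct.induction_on with
  | zero => simpa using h0
  | tmul u x => simpa using ht u u.2 x
  | add y z hy hz => rw [map_add]; exact ha _ _ hy hz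

theorem smul_mem_clTensor {X : Type*} [AddCommMonoid X] [Module R X] {i j : ZMod 2} {u : Cl g}
    (hu : u ∈ clParity g i) {y : Cl g ⊗[R] X} (hy : y ∈ clTensor (clParity g j) X) :
    u • y ∈ clTensor (clParity g (i + j)) X := by
  refine clTensor_induction (p := fun y => u • y ∈ clTensor (clParity g (i + j)) X) ?_ ?_ ?_ hy
  · rw [smul_zero]; exact zero_mem _
  · intro v hv x
    rw [TensorProduct.smul_tmul', smul_eq_mul]
    exact tmul_mem_clTensor (CliffordAlgebra.evenOdd_mul_le _ i j (Submodule.mul_mem_mul hu hv)) x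
  · intro y z hy hz
    rw [smul_add]; exact add_mem hy hz

theorem exists_parity_decomp {X : Type*} [AddCommMonoid X] [Module R X] (i : ZMod 2)
    (z : Cl g ⊗[R] X) : ∃ y ∈ clTensor (clParity g i) X, ∃ y' ∈ clTensor (clParity g (i + 1)) X,
      z = y + y' := by
  have h : clTensor (clParity g i) X ⊔ clTensor (clParity g (i + 1)) X = ⊤ := by
    have htop : clParity g i ⊔ clParity g (i + 1) = ⊤ := by
      have := (CliffordAlgebra.evenOdd_isCompl (-(LinearMap.BilinMap.toQuadraticMap g))).sup_eq_top
      fin_cases i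
      · exact this
      · rw [sup_comm]; exact this
    rw [eq_top_iff]
    rintro z -
    induction z using TensorProduct.induction_on with
    | zero => exact zero_mem _
    | add y z hy hz => exact add_mem hy hz
    | tmul u x =>
      obtain ⟨v, hv, v', hv', rfl⟩ := Submodule.mem_sup.1 (htop ▸ Submodule.mem_top : u ∈ _)
      rw [TensorProduct.add_tmul]
      exact Submodule.add_mem_sup (tmul_mem_clTensor hv x) (tmul_mem_clTensor hv' x)
  obtain ⟨y, hy, y', hy', rfl⟩ := Submodule.mem_sup.1 (h ▸ Submodule.mem_top : z ∈ _)
  exact ⟨y, hy, y', hy', rfl⟩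

/-- The grading involution of the Clifford algebra separates even from odd elements. -/
theorem disjoint_parity [Algebra ℝ R] {X : Type*} [AddCommMonoid X] [Module R X] (i : ZMod 2) :
    Disjoint (clTensor (clParity g i) X) (clTensor (clParity g (i + 1)) X) := by
  have h : Disjoint (clTensor (clParity g 0) X) (clTensor (clParity g 1) X) := by
    rw [Submodule.disjoint_def]
    intro y h0 h1
    let τ := LinearMap.rTensor X (CliffordAlgebra.involute
      (Q := -(LinearMap.BilinMap.toQuadraticMap g))).toLinearMap
    have e0 : τ y = y := by
      refine clTensor_induction (p := fun y => τ y = y) (map_zero _) ?_ ?_ h0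
      · intro u hu x
        simp only [τ, LinearMap.rTensor_tmul, AlgHom.toLinearMap_apply,
          CliffordAlgebra.involute_eq_of_mem_even hu]
      · intro y z hy hz
        rw [map_add, hy, hz]
    have e1 : τ y = -y := by
      refine clTensor_induction (p := fun y => τ y = -y) (by simp) ?_ ?_ h1
      · intro u hu x
        simp only [τ, LinearMap.rTensor_tmul, AlgHom.toLinearMap_apply,
          CliffordAlgebra.involute_eq_of_mem_odd hu, TensorProduct.neg_tmul]
      · intro y z hy hz
        rw [map_add, hy, hz, neg_add]
    have e2 : y + y = 0 := by
      nth_rewrite 1 [← e0]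
      rw [e1, neg_add_cancel]
    exact eq_zero_of_add_self_eq_zero (R := R) e2
  fin_cases i
  · exact h
  · exact h.symm

end CliffordGeneral

/-! ### Submodules and quotients spanned by part of a basis -/

section AdaptedBasis

variable {R S L ι κ : Type*} [CommRing R] [Ring S] [Algebra R S] [AddCommGroup L] [Module R L]
  [Module S L] [IsScalarTower R S L]

/-- A submodule that contains the second part of a basis and does not meet the span of the first
part is spanned by the second part. -/
theorem eq_span_of_disjoint (c : Module.Basis (ι ⊕ κ) S L) {I : Submodule S L}
    (hI : ∀ j, c (Sum.inr j) ∈ I)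
    (hdisj : Disjoint (Submodule.span S (Set.range (c ∘ Sum.inl))) I) :
    I = Submodule.span S (Set.range (c ∘ Sum.inr)) := by
  have hle : Submodule.span S (Set.range (c ∘ Sum.inr)) ≤ I :=
    Submodule.span_le.2 (by rintro _ ⟨i, rfl⟩; exact hI i)
  refine le_antisymm (fun y hy => ?_) hle
  have htop : y ∈ Submodule.span S (Set.range (c ∘ Sum.inl)) ⊔
      Submodule.span S (Set.range (c ∘ Sum.inr)) := by
    rw [← Submodule.span_union, ← Set.Sum.elim_range, Sum.elim_comp_inl_inr, c.span_eq]
    trivial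
  obtain ⟨a, ha, b, hb, rfl⟩ := Submodule.mem_sup.1 htop
  have ha0 : a = 0 := Submodule.disjoint_def.1 hdisj a ha (by simpa using sub_mem hy (hle hb))
  rwa [ha0, zero_add]

theorem exists_equiv_total (hinj : Function.Injective (algebraMap R S))
    (c : Module.Basis (ι ⊕ κ) S L) :
    ∃ e : (S ⊗[R] (Submodule.span R (Set.range (c ∘ Sum.inl)) ×
        Submodule.span R (Set.range (c ∘ Sum.inr)))) ≃ₗ[S] L,
      ∀ u a b, e (u ⊗ₜ[R] (a, b)) = u • ((a : L) + b) := by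
  have hli : LinearIndependent R c := c.linearIndependent.restrict_scalars fun a b hab =>
    hinj (by simpa [Algebra.algebraMap_eq_smul_one] using hab)
  let bA := Module.Basis.span (hli.comp Sum.inl Sum.inl_injective)
  let bB := Module.Basis.span (hli.comp Sum.inr Sum.inr_injective)
  obtain ⟨e, he⟩ := exists_baseChange_equiv (S := S) (bA.prod bB) c
    ((Submodule.subtype _).coprod (Submodule.subtype _)) (by
      rintro (i | j)
      · simp [bA]
      · simp [bB])
  exact ⟨e, fun u a b => by rw [he]; rfl⟩

theorem exists_equiv_sub (hinj : Function.Injective (algebraMap R S))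
    (c : Module.Basis (ι ⊕ κ) S L) {I : Submodule S L}
    (hI : I = Submodule.span S (Set.range (c ∘ Sum.inr))) :
    ∃ e : (S ⊗[R] Submodule.span R (Set.range (c ∘ Sum.inr))) ≃ₗ[S] I,
      ∀ u b, (e (u ⊗ₜ[R] b) : L) = u • (b : L) := by
  have hli : LinearIndependent R c := c.linearIndependent.restrict_scalars fun a b hab =>
    hinj (by simpa [Algebra.algebraMap_eq_smul_one] using hab)
  have hle : ∀ b ∈ Submodule.span R (Set.range (c ∘ Sum.inr)), b ∈ I := fun b hb =>
    hI ▸ Submodule.span_le_restrictScalars R S _ hb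
  let φ : Submodule.span R (Set.range (c ∘ Sum.inr)) →ₗ[R] I :=
    { toFun := fun b => ⟨b, hle b b.2⟩
      map_add' := fun _ _ => rfl
      map_smul' := fun _ _ => rfl }
  let yI : Module.Basis κ S I :=
    (Module.Basis.span (c.linearIndependent.comp Sum.inr Sum.inr_injective)).map
      (LinearEquiv.ofEq _ _ hI.symm)
  obtain ⟨e, he⟩ := exists_baseChange_equiv (S := S) (Y := I)
    (Module.Basis.span (hli.comp Sum.inr Sum.inr_injective)) yI φ
    (fun j => Subtype.ext (by simp [yI, φ]))
  exact ⟨e, fun u b => by rw [he]; rfl⟩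

theorem exists_equiv_quot (hinj : Function.Injective (algebraMap R S))
    (c : Module.Basis (ι ⊕ κ) S L) {I : Submodule S L}
    (hI : I = Submodule.span S (Set.range (c ∘ Sum.inr))) :
    ∃ e : (S ⊗[R] Submodule.span R (Set.range (c ∘ Sum.inl))) ≃ₗ[S] L ⧸ I,
      ∀ u a, e (u ⊗ₜ[R] a) = I.mkQ (u • (a : L)) := by
  have hli : LinearIndependent R c := c.linearIndependent.restrict_scalars fun a b hab =>
    hinj (by simpa [Algebra.algebraMap_eq_smul_one] using hab)
  have hcl := linearIndependent_sum.1 c.linearIndependent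
  have hliE : LinearIndependent S (I.mkQ ∘ (c ∘ Sum.inl)) :=
    hcl.1.map (by rw [Submodule.ker_mkQ, hI]; exact hcl.2.2)
  let yE : Module.Basis ι S (L ⧸ I) := Module.Basis.mk hliE (by
    rintro y -
    obtain ⟨y, rfl⟩ := I.mkQ_surjective y
    have hy : y ∈ Submodule.span S (Set.range c) := by rw [c.span_eq]; trivial
    have : Submodule.span S (Set.range c) ≤ (Submodule.span S
        (Set.range (I.mkQ ∘ (c ∘ Sum.inl)))).comap I.mkQ := by
      rw [Submodule.span_le]
      rintro _ ⟨i | j, rfl⟩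
      · exact Submodule.subset_span ⟨i, rfl⟩
      · have h0 : I.mkQ (c (Sum.inr j)) = 0 :=
          (Submodule.Quotient.mk_eq_zero _).2 (hI ▸ Submodule.subset_span ⟨j, rfl⟩)
        exact Submodule.mem_comap.2 (h0 ▸ Submodule.zero_mem _)
    exact this hy)
  obtain ⟨e, he⟩ := exists_baseChange_equiv (S := S)
    (Module.Basis.span (hli.comp Sum.inl Sum.inl_injective)) yE
    (I.mkQ.restrictScalars R ∘ₗ Submodule.subtype _) (fun i => by simp [yE])
  exact ⟨e, fun u a => by rw [he, map_smul]; rfl⟩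

end AdaptedBasis

/-! ### Graded isomorphisms -/

section FreePair

variable {R : Type*} [CommRing R] {W : Type*} [AddCommGroup W] [Module R W]
  {g : LinearMap.BilinForm R W} {N : Type*} [AddCommMonoid N] [Module R N]

/-- A `Cl`-linear isomorphism from `Cl ⊗ X` (with `X` even) to `Y` maps the elements of each parity
onto the given submodule of `Y`. -/
def MapsParity {X Y : Type*} [AddCommMonoid X] [Module R X] [AddCommMonoid Y]
    [Module (Cl g) Y] [Module R Y] [IsScalarTower R (Cl g) Y]
    (parity : ZMod 2 → Submodule R Y) (e : (Cl g ⊗[R] X) ≃ₗ[Cl g] Y) : Prop :=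
  ∀ i : ZMod 2, (clTensor (clParity g i) X).map
    ((e : (Cl g ⊗[R] X) →ₗ[Cl g] Y).restrictScalars R) = parity i

/-- It suffices that even and odd elements are mapped into disjoint submodules, because the source
is the sum of its two parities. -/
theorem mapsParity_of_disjoint {X Y : Type*} [AddCommMonoid X] [Module R X] [AddCommGroup Y]
    [Module (Cl g) Y] [Module R Y] [IsScalarTower R (Cl g) Y]
    {parity : ZMod 2 → Submodule R Y} (hdisj : ∀ i, Disjoint (parity i) (parity (i + 1)))
    (e : (Cl g ⊗[R] X) ≃ₗ[Cl g] Y)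
    (he : ∀ i, ∀ u ∈ clParity g i, ∀ x, e (u ⊗ₜ[R] x) ∈ parity i) :
    MapsParity parity e := by
  have hmap : ∀ i, ∀ z ∈ clTensor (clParity g i) X, e z ∈ parity i := by
    intro i z hz
    refine clTensor_induction (p := fun z => e z ∈ parity i) ?_ (he i) ?_ hz
    · rw [map_zero]; exact zero_mem _
    · intro y z hy hz
      rw [map_add]; exact add_mem hy hz
  intro i
  apply le_antisymm
  · rintro _ ⟨z, hz, rfl⟩
    exact hmap i z hz
  · intro y hy
    obtain ⟨z, hz, z', hz', h⟩ := exists_parity_decomp i (e.symm y)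
    have hy' : y = e z + e z' := by rw [← map_add, ← h, e.apply_symm_apply]
    have h0 : e z' = 0 := by
      refine Submodule.disjoint_def.1 (hdisj i) _ ?_ (hmap _ z' hz')
      rw [show e z' = y - e z by rw [hy']; abel]
      exact sub_mem hy (hmap i z hz)
    exact ⟨z, hz, by rw [hy', h0, add_zero]; rfl⟩

theorem smul_mem_parity {i : ZMod 2} {u : Cl g} (hu : u ∈ clParity g i) {y : Cl g ⊗[R] N}
    (hy : y ∈ clTensor (clParity g 0) N) : u • y ∈ clTensor (clParity g i) N := by
  have := smul_mem_clTensor hu hy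
  rwa [add_zero] at this

/-- The elements of parity `i` of a `Cl`-submodule of `Cl ⊗ N`. -/
def subParity (I : Submodule (Cl g) (Cl g ⊗[R] N)) (i : ZMod 2) : Submodule R I :=
  (clTensor (clParity g i) N).comap (I.subtype.restrictScalars R)

/-- The elements of parity `i` of a quotient of `Cl ⊗ N`. -/
def quotParity (I : Submodule (Cl g) (Cl g ⊗[R] N)) (i : ZMod 2) :
    Submodule R ((Cl g ⊗[R] N) ⧸ I) :=
  (clTensor (clParity g i) N).map (I.mkQ.restrictScalars R)

variable {I : Submodule (Cl g) (Cl g ⊗[R] N)}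

theorem mapsParity_sub [Algebra ℝ R] {X : Type*} [AddCommMonoid X] [Module R X]
    (e : (Cl g ⊗[R] X) ≃ₗ[Cl g] I) (φ : X → Cl g ⊗[R] N)
    (hφ : ∀ x, φ x ∈ clTensor (clParity g 0) N)
    (he : ∀ u x, (e (u ⊗ₜ[R] x) : Cl g ⊗[R] N) = u • φ x) :
    MapsParity (subParity I) e := by
  refine mapsParity_of_disjoint (Y := I) (parity := subParity I) (fun i => ?_) e
    fun i u hu x => ?_
  · rw [Submodule.disjoint_def]
    intro y h0 h1
    exact Subtype.ext (Submodule.disjoint_def.1 (disjoint_parity i) _ h0 h1)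
  · change (e (u ⊗ₜ[R] x) : Cl g ⊗[R] N) ∈ clTensor (clParity g i) N
    rw [he]
    exact smul_mem_parity hu (hφ x)

/-- If a submodule is generated by even elements, then it is a graded submodule, so that the
two parities of the quotient are disjoint. -/
theorem disjoint_quotParity [Algebra ℝ R] {X : Type*} [AddCommMonoid X] [Module R X]
    (e : (Cl g ⊗[R] X) ≃ₗ[Cl g] I) (he : MapsParity (subParity I) e)
    (i : ZMod 2) : Disjoint (quotParity I i) (quotParity I (i + 1)) := by
  have hgraded : ∀ y ∈ clTensor (clParity g i) N, ∀ y' ∈ clTensor (clParity g (i + 1)) N,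
      y - y' ∈ I → y ∈ I := by
    intro y hy y' hy' h
    obtain ⟨z, hz, z', hz', hzz⟩ := exists_parity_decomp i (e.symm ⟨_, h⟩)
    have h1 : (⟨_, h⟩ : I) = e z + e z' := by
      rw [← map_add, ← hzz, e.apply_symm_apply]
    have h2 : y - y' = (e z : Cl g ⊗[R] N) + e z' := congrArg Subtype.val h1
    have m1 : e z ∈ subParity I i := he i ▸ ⟨z, hz, rfl⟩
    have m2 : e z' ∈ subParity I (i + 1) := he (i + 1) ▸ ⟨z', hz', rfl⟩
    have h3 : y - e z = 0 := by
      refine Submodule.disjoint_def.1 (disjoint_parity i) _ (sub_mem hy m1) ?_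
      rw [show y - (e z : Cl g ⊗[R] N) = y' + e z' by
        rw [sub_eq_iff_eq_add] at h2 ⊢
        rw [h2]; abel]
      exact add_mem hy' m2
    rw [sub_eq_zero.1 h3]
    exact (e z).2
  rw [Submodule.disjoint_def]
  rintro _ ⟨y, hy, rfl⟩ ⟨y', hy', h⟩
  refine (Submodule.Quotient.mk_eq_zero _).2 (hgraded y hy y' hy' ?_)
  exact (Submodule.Quotient.eq _).1 h.symm

theorem mapsParity_quot {X : Type*} [AddCommMonoid X] [Module R X]
    (hdisj : ∀ i, Disjoint (quotParity I i) (quotParity I (i + 1)))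
    (e : (Cl g ⊗[R] X) ≃ₗ[Cl g] (Cl g ⊗[R] N) ⧸ I) (φ : X → Cl g ⊗[R] N)
    (hφ : ∀ x, φ x ∈ clTensor (clParity g 0) N)
    (he : ∀ u x, e (u ⊗ₜ[R] x) = I.mkQ (u • φ x)) :
    MapsParity (quotParity I) e := by
  refine mapsParity_of_disjoint hdisj e fun i u hu x => ?_
  rw [he]
  exact ⟨u • φ x, smul_mem_parity hu (hφ x), rfl⟩

/-- A `Cl`-basis of `Cl ⊗ N` that consists of even elements and whose second part generates `I`
yields free `R`-modules `A` and `B` and graded isomorphisms of `Cl ⊗ (A ⊕ B)`, `Cl ⊗ B`, `Cl ⊗ A`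
with `Cl ⊗ N`, `I`, and the quotient. -/
theorem exists_graded_equivs [Algebra ℝ R] [Nontrivial R] {ι κ : Type} [Fintype ι] [Fintype κ]
    (c : Module.Basis (ι ⊕ κ) (Cl g) (Cl g ⊗[R] N))
    (hc : ∀ i, c i ∈ clTensor (clParity g 0) N)
    (hB : ∀ j, c (Sum.inr j) ∈ I)
    (hinj : Disjoint (Submodule.span (Cl g) (Set.range (c ∘ Sum.inl))) I)
    (A B : Submodule R (Cl g ⊗[R] N)) (hAc : A = Submodule.span R (Set.range (c ∘ Sum.inl)))
    (hBc : B = Submodule.span R (Set.range (c ∘ Sum.inr))) :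
    Module.Free R A ∧ Module.Free R B ∧ Module.finrank R A = Fintype.card ι ∧
    Module.finrank R B = Fintype.card κ ∧
    (∃ e : (Cl g ⊗[R] (A × B)) ≃ₗ[Cl g] Cl g ⊗[R] N,
      MapsParity (fun i => clTensor (clParity g i) N) e ∧
      ∀ (u : Cl g) (a : A) (b : B), e (u ⊗ₜ[R] (a, b)) = u • ((a : Cl g ⊗[R] N) + b)) ∧
    (∃ e : (Cl g ⊗[R] B) ≃ₗ[Cl g] I, MapsParity (subParity I) e ∧
      ∀ (u : Cl g) (b : B), (e (u ⊗ₜ[R] b) : Cl g ⊗[R] N) = u • (b : Cl g ⊗[R] N)) ∧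
    (∃ e : (Cl g ⊗[R] A) ≃ₗ[Cl g] (Cl g ⊗[R] N) ⧸ I, MapsParity (quotParity I) e ∧
      ∀ (u : Cl g) (a : A), e (u ⊗ₜ[R] a) = I.mkQ (u • (a : Cl g ⊗[R] N))) := by
  have hS := algebraMap_cl_injective g
  have hli : LinearIndependent R c := by
    refine c.linearIndependent.restrict_scalars (R := R) (K := Cl g) fun a b hab => hS ?_
    simpa [Algebra.algebraMap_eq_smul_one] using hab
  have hliA := hli.comp Sum.inl Sum.inl_injective
  have hliB := hli.comp Sum.inr Sum.inr_injective
  have evA : A ≤ clTensor (clParity g 0) N :=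
    hAc ▸ Submodule.span_le.2 (by rintro _ ⟨i, rfl⟩; exact hc _)
  have evB : B ≤ clTensor (clParity g 0) N :=
    hBc ▸ Submodule.span_le.2 (by rintro _ ⟨i, rfl⟩; exact hc _)
  have hI := eq_span_of_disjoint c hB hinj
  subst hAc hBc
  obtain ⟨eL, heL⟩ := exists_equiv_total hS c
  obtain ⟨eI, heI⟩ := exists_equiv_sub hS c hI
  obtain ⟨eE, heE⟩ := exists_equiv_quot hS c hI
  have hgrI := mapsParity_sub eI (fun b => (b : Cl g ⊗[R] N)) (fun b => evB b.2) heI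
  refine ⟨Module.Free.of_basis (Module.Basis.span hliA),
    Module.Free.of_basis (Module.Basis.span hliB),
    Module.finrank_eq_card_basis (Module.Basis.span hliA),
    Module.finrank_eq_card_basis (Module.Basis.span hliB),
    ⟨eL, mapsParity_of_disjoint disjoint_parity eL fun i u hu x => ?_, heL⟩,
    ⟨eI, hgrI, heI⟩,
    ⟨eE, mapsParity_quot (disjoint_quotParity eI hgrI) eE
        (fun a => (a : Cl g ⊗[R] N)) (fun a => evA a.2) heE, heE⟩⟩
  obtain ⟨a, b⟩ := x
  rw [heL]
  exact smul_mem_parity hu (add_mem (evA a.2) (evB b.2))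

end FreePair

/-! ### Relations in Lorentzian Clifford algebras -/

section CliffordRelations

/-- The Clifford relations `v w + w v + 2 ⟨v, w⟩ = 0` among four generators `tᵢ` whose matrix of
inner products is `z • diag(-1, 1, 1, 1)`, with a central unit `z`. -/
structure LorentzRelations {S : Type*} [Ring S] (t : Fin 4 → S) (z : S) : Prop where
  comm : ∀ x, z * x = x * z
  unit : IsUnit z
  sq_zero : t 0 * t 0 = z
  sq : ∀ i, i ≠ 0 → t i * t i = -z
  anti : ∀ i j, i ≠ j → t i * t j = -(t j * t i)

namespace LorentzRelations

variable {S : Type*} [Ring S] {t : Fin 4 → S} {z : S}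

theorem isUnit (h : LorentzRelations t z) (i : Fin 4) : IsUnit (t i) := by
  by_cases hi : i = 0
  · subst hi
    exact ((Commute.refl (t 0)).isUnit_mul_iff.1 (h.sq_zero ▸ h.unit)).1
  · exact ((Commute.refl (t i)).isUnit_mul_iff.1 (h.sq i hi ▸ h.unit.neg)).1

theorem eq_zero_of_mul (h : LorentzRelations t z) (i : Fin 4) {x : S} (hx : x * t i = 0) : x = 0 :=
  (h.isUnit i).mul_left_eq_zero.1 hx

/-- The equations that express that `a σ₁ + b σ₂ + c σ₃ + d σ₂₃` annihilates `θ₀, …, θ₃` have only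
the trivial solution. -/
theorem eq_zero_of_system (h : LorentzRelations t z) (h2 : ∀ x : S, x + x = 0 → x = 0)
    {a b c d : S} (e0 : a * t 1 + b * t 2 + c * t 3 = 0) (e1 : a * t 0 = 0)
    (e2 : b * t 0 = d * t 3) (e3 : c * t 0 = -(d * t 2)) : a = 0 ∧ b = 0 ∧ c = 0 ∧ d = 0 := by
  have ha : a = 0 := h.eq_zero_of_mul 0 e1
  have hd : d = 0 := by
    have e4 : b * t 0 * t 2 + c * t 0 * t 3 = 0 := by
      have := congrArg (· * t 0) e0
      simp only [ha, zero_mul, zero_add, add_mul, mul_assoc] at this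
      rw [h.anti 2 0 (by decide), h.anti 3 0 (by decide), mul_neg, mul_neg, ← neg_add,
        neg_eq_zero] at this
      simpa only [mul_assoc] using this
    rw [e2, e3, mul_assoc, h.anti 3 2 (by decide), neg_mul, mul_assoc, mul_neg, ← neg_add,
      neg_eq_zero] at e4
    have e5 := h2 _ e4
    rw [← mul_assoc] at e5
    exact h.eq_zero_of_mul 2 (h.eq_zero_of_mul 3 e5)
  refine ⟨ha, h.eq_zero_of_mul 0 ?_, h.eq_zero_of_mul 0 ?_, hd⟩
  · rw [e2, hd, zero_mul]
  · rw [e3, hd, zero_mul, neg_zero]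

theorem mul_sq_zero (h : LorentzRelations t z) (x : S) : x * t 0 * t 0 = z * x := by
  rw [mul_assoc, h.sq_zero, h.comm]

theorem mul_sq (h : LorentzRelations t z) {i : Fin 4} (hi : i ≠ 0) (x : S) :
    x * t i * t i = -(z * x) := by
  rw [mul_assoc, h.sq i hi, mul_neg, h.comm]

theorem conj_zero (h : LorentzRelations t z) {i : Fin 4} (hi : i ≠ 0) :
    t i * t 0 * t i = z * t 0 := by
  rw [h.anti i 0 hi, neg_mul, h.mul_sq hi, neg_neg]

theorem conj (h : LorentzRelations t z) {i j : Fin 4} (hi : i ≠ 0) (hij : i ≠ j) :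
    t i * t j * t i = z * t j := by
  rw [h.anti i j hij, neg_mul, h.mul_sq hi, neg_neg]

end LorentzRelations

variable {R : Type*} [CommRing R] {W : Type*} [AddCommGroup W] [Module R W]
  {g : LinearMap.BilinForm R W} {θ : Module.Basis (Fin 4) R W}

theorem lorentzRelations_of_orthogonal {ψ : R} (hψ : IsUnit ψ)
    (hg : ∀ i j, g (θ i) (θ j) = ψ * eta R i j) :
    LorentzRelations (fun i => clι g (θ i)) (algebraMap R (Cl g) ψ) where
  comm := Algebra.commutes ψ
  unit := hψ.map _
  sq_zero := by
    rw [CliffordAlgebra.ι_sq_scalar]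
    simp [hg, eta]
  sq i hi := by
    rw [CliffordAlgebra.ι_sq_scalar]
    simp [hg, eta_self hi]
  anti i j hij := by
    rw [eq_neg_iff_add_eq_zero, CliffordAlgebra.ι_mul_ι_add_swap]
    simp [QuadraticMap.polar, hg, eta_of_ne hij, eta_of_ne hij.symm]

end CliffordRelations

/-! ### The components of the morphism to triples -/

section Components

variable {R : Type*} [CommRing R] [Algebra ℝ R]
  {W : Type*} [AddCommGroup W] [Module R W] [Module ℝ W] [IsScalarTower ℝ R W]
  {g : LinearMap.BilinForm R W} {D : Submodule R (derEnd R W)}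

/-- The action of `Cl ⊗ D` on a scalar. -/
def actR (g : LinearMap.BilinForm R W) (D : Submodule R (derEnd R W)) (a : R) :
    Cl g ⊗[R] D →ₗ[Cl g] Cl g where
  toFun y := (slashHom g D y).1.1 a
  map_add' y z := by rw [map_add]; rfl
  map_smul' u y := by rw [map_smul]; rfl

/-- The action of `Cl ⊗ D` on an element of `W`. -/
def actW (g : LinearMap.BilinForm R W) (D : Submodule R (derEnd R W)) (w : W) :
    Cl g ⊗[R] D →ₗ[Cl g] Cl g where
  toFun y := (slashHom g D y).1.2.1 w
  map_add' y z := by rw [map_add]; rfl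
  map_smul' u y := by rw [map_smul]; rfl

/-- The action of `Cl ⊗ D` on an element of `⋀⁴ W`. -/
def actΩ (g : LinearMap.BilinForm R W) (D : Submodule R (derEnd R W)) (η : ⋀[R]^4 W) :
    Cl g ⊗[R] D →ₗ[Cl g] Cl g ⊗[R] ⋀[R]^4 W where
  toFun y := (slashHom g D y).1.2.2 η
  map_add' y z := by rw [map_add]; rfl
  map_smul' u y := by rw [map_smul]; rfl

theorem actR_tmul (a : R) (u : Cl g) (δ : D) :
    actR g D a (u ⊗ₜ[R] δ) = u * algebraMap R (Cl g) (δ.1.1.1 a) :=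
  rfl

theorem actW_tmul (w : W) (u : Cl g) (δ : D) :
    actW g D w (u ⊗ₜ[R] δ) = u * clι g (δ.1.1.2 w) :=
  rfl

theorem actΩ_tmul (η : ⋀[R]^4 W) (u : Cl g) (δ : D) :
    actΩ g D η (u ⊗ₜ[R] δ) = u ⊗ₜ[R] extDerTop δ.1 η := by
  change u • ((1 : Cl g) ⊗ₜ[R] extDerTop δ.1 η) = _
  rw [TensorProduct.smul_tmul', smul_eq_mul, mul_one]

theorem mem_ker_slashHom {y : Cl g ⊗[R] D} : y ∈ LinearMap.ker (slashHom g D) ↔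
    (∀ a, actR g D a y = 0) ∧ (∀ w, actW g D w y = 0) ∧ ∀ η, actΩ g D η y = 0 := by
  rw [LinearMap.mem_ker]
  constructor
  · intro h
    refine ⟨fun a => ?_, fun w => ?_, fun η => ?_⟩
    · change (slashHom g D y).1.1 a = 0
      rw [h]; rfl
    · change (slashHom g D y).1.2.1 w = 0
      rw [h]; rfl
    · change (slashHom g D y).1.2.2 η = 0
      rw [h]; rfl
  · rintro ⟨h1, h2, h3⟩
    exact Subtype.ext (Prod.ext (LinearMap.ext h1) (Prod.ext (LinearMap.ext h2) (LinearMap.ext h3)))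

end Components

/-! ### Traces and the top exterior power -/

section Frame

variable {R : Type*} [CommRing R] {W : Type*} [AddCommGroup W] [Module R W]
  {θ : Module.Basis (Fin 4) R W}

/-- The volume element of a basis generates `⋀⁴ W` freely: the determinant maps it to `1`. -/
theorem eq_zero_of_tmul_ιMulti_basis (θ : Module.Basis (Fin 4) R W) {S : Type*} [Ring S]
    [Algebra R S] {u : S} (h : u ⊗ₜ[R] exteriorPower.ιMulti R 4 (θ : Fin 4 → W) = 0) : u = 0 := by
  have h1 := congrArg (TensorProduct.rid R S ∘
    LinearMap.lTensor S (exteriorPower.alternatingMapLinearEquiv θ.det)) h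
  simpa [exteriorPower.alternatingMapLinearEquiv_apply_ιMulti, θ.det_self] using h1

/-- The endomorphisms `σ₀, σ₁, σ₂, σ₃, σ₂₃`. -/
def sigmaA (θ : Module.Basis (Fin 4) R W) : Fin 5 → (W →ₗ[R] W) :=
  ![LinearMap.id, boost θ 1, boost θ 2, boost θ 3, rotation θ 2 3]

theorem boost_basis (i k : Fin 4) :
    boost θ i (θ k) = if k = 0 then θ i else if i = k then θ 0 else 0 := by
  rw [boost, Module.Basis.constr_basis]

theorem rotation_basis (i j k : Fin 4) :
    rotation θ i j (θ k) = (if j = k then θ i else 0) - if i = k then θ j else 0 := by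
  rw [rotation, Module.Basis.constr_basis]

theorem trace_boost (i : Fin 4) (hi : i ≠ 0) : ∑ k, θ.repr (boost θ i (θ k)) k = 0 := by
  fin_cases i <;> simp_all [boost_basis, Fin.sum_univ_four]

theorem trace_rotation (i j : Fin 4) (hij : i ≠ j) : ∑ k, θ.repr (rotation θ i j (θ k)) k = 0 := by
  refine Finset.sum_eq_zero fun k _ => ?_
  rw [rotation_basis]
  split_ifs <;> simp_all

end Frame

section TopPower

variable {R : Type*} [CommRing R] [Algebra ℝ R]
  {W : Type*} [AddCommGroup W] [Module R W] [Module ℝ W] [IsScalarTower ℝ R W]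

theorem extDer_vertical_ιMulti (T : W →ₗ[R] W) (v : Fin 4 → W) :
    extDerTop (vertical T) (exteriorPower.ιMulti R 4 v) =
      ∑ i, exteriorPower.ιMulti R 4 (Function.update v i (T (v i))) := by
  apply Subtype.ext
  change extDer (vertical T) (ExteriorAlgebra.ιMulti R 4 v) = _
  rw [Fin.sum_univ_four]
  simp only [Submodule.coe_add, exteriorPower.ιMulti_apply_coe, ExteriorAlgebra.ιMulti_apply,
    List.ofFn_succ, List.ofFn_zero, List.prod_cons, List.prod_nil, mul_one, extDer_mul, extDer_ι,
    Fin.succ_zero_eq_one, Fin.succ_one_eq_two]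
  simp [Function.update, vertical, mul_add, add_assoc]

/-- On the top exterior power, an endomorphism acts as multiplication by its trace. -/
theorem extDerTop_vertical_basis (θ : Module.Basis (Fin 4) R W) (T : W →ₗ[R] W) :
    extDerTop (vertical T) (exteriorPower.ιMulti R 4 θ) =
      (∑ i, θ.repr (T (θ i)) i) • exteriorPower.ιMulti R 4 θ := by
  rw [extDer_vertical_ιMulti, Finset.sum_smul]
  refine Finset.sum_congr rfl fun i _ => ?_
  conv_lhs => rw [← θ.sum_repr (T (θ i))]
  rw [AlternatingMap.map_update_sum, Finset.sum_eq_single i]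
  · rw [AlternatingMap.map_update_smul, Function.update_eq_self]
  · intro j _ hj
    rw [AlternatingMap.map_update_smul, AlternatingMap.map_update_self _ _ hj.symm, smul_zero]
  · simp

theorem extDerTop_vertical_eq_zero (θ : Module.Basis (Fin 4) R W) {T : W →ₗ[R] W}
    (hT : ∑ i, θ.repr (T (θ i)) i = 0) (η : ⋀[R]^4 W) : extDerTop (vertical T) η = 0 := by
  let F : ⋀[R]^4 W →ₗ[R] ⋀[R]^4 W :=
    { extDerTop (vertical T) with
      map_smul' := fun a η => Subtype.ext <| by
        change extDer (vertical T) (a • η.1) = a • extDer (vertical T) η.1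
        rw [extDer_smul]
        simp [vertical] }
  suffices h : F = 0 from LinearMap.congr_fun h η
  apply exteriorPower.linearMap_ext
  refine θ.ext_alternating fun v hv => ?_
  have hσ : Function.Bijective v := Finite.injective_iff_bijective.1 hv
  have h0 : F (exteriorPower.ιMulti R 4 θ) = 0 := by
    change extDerTop (vertical T) _ = 0
    rw [extDerTop_vertical_basis, hT, zero_smul]
  have h1 := (exteriorPower.ιMulti R 4).map_perm (θ : Fin 4 → W) (Equiv.ofBijective v hσ)
  change F (exteriorPower.ιMulti R 4 (θ ∘ Equiv.ofBijective v hσ)) = 0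
  rw [h1, Units.smul_def, map_zsmul, h0, smul_zero]

end TopPower

/-! ### The kernel and the elements it does not contain -/

section Kernel

variable {R : Type*} [CommRing R] [Algebra ℝ R]
  {W : Type*} [AddCommGroup W] [Module R W] [Module ℝ W] [IsScalarTower ℝ R W]
  {g : LinearMap.BilinForm R W} {D : Submodule R (derEnd R W)} {θ : Module.Basis (Fin 4) R W}

/-- No nonzero `Cl`-combination of the lifted derivations `∂₀, …, ∂₃` and of
`σ₀, σ₁, σ₂, σ₃, σ₂₃` is in the kernel: its values on coordinate functions determine the
coefficients of the `∂ᵢ`, its value on the volume element determines the coefficient of `σ₀`, the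
only one of the endomorphisms with a trace, and its values on `θ₀, …, θ₃` the other ones. -/
theorem eq_zero_of_sum_mem_ker {z : Cl g} (ht : LorentzRelations (fun i => clι g (θ i)) z)
    {d : Fin 4 → Derivation ℝ R R} {x : Fin 4 → R} (hx : ∀ i j, d i (x j) = if i = j then 1 else 0)
    {n : Fin 4 → D} {m : Fin 5 → D} (hn : ∀ i, (n i).1 = derLift θ (d i))
    (hm : ∀ k, (m k).1 = vertical (sigmaA θ k)) {u : Fin 4 → Cl g} {p : Fin 5 → Cl g}
    (h : ∑ i, u i ⊗ₜ[R] n i + ∑ k, p k ⊗ₜ[R] m k ∈ LinearMap.ker (slashHom g D)) :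
    u = 0 ∧ p = 0 := by
  obtain ⟨hR, hW, hΩ⟩ := mem_ker_slashHom.1 h
  have hu : u = 0 := by
    funext j
    have h1 := hR (x j)
    simp only [map_add, map_sum, actR_tmul, hn, hm] at h1
    simpa [derLift, vertical, hx] using h1
  subst hu
  simp only [Pi.zero_apply, TensorProduct.zero_tmul, Finset.sum_const_zero, zero_add] at hW hΩ
  have h0 : p 0 = 0 := by
    have h1 := hΩ (exteriorPower.ιMulti R 4 θ)
    rw [map_sum] at h1
    simp only [actΩ_tmul, hm, Fin.sum_univ_five, sigmaA, Matrix.cons_val,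
      extDerTop_vertical_basis, trace_boost 1 (by decide), trace_boost 2 (by decide),
      trace_boost 3 (by decide), trace_rotation 2 3 (by decide), zero_smul,
      TensorProduct.tmul_zero, add_zero] at h1
    rw [← TensorProduct.smul_tmul] at h1
    have h2 := eq_zero_of_tmul_ιMulti_basis θ h1
    simp only [Fin.sum_univ_four, LinearMap.id_apply, Module.Basis.repr_self,
      Finsupp.single_eq_same] at h2
    have h3 : (1 + 1 + 1 + 1 : R) • p 0 = (p 0 + p 0) + (p 0 + p 0) := by
      simp only [add_smul, one_smul]; abel
    rw [h3] at h2
    exact eq_zero_of_add_self_eq_zero (R := R) (eq_zero_of_add_self_eq_zero (R := R) h2)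
  have e (k : Fin 4) : ∑ i, actW g D (θ k) (p i ⊗ₜ[R] m i) = 0 := by
    rw [← map_sum, hW]
  simp only [actW_tmul, hm, Fin.sum_univ_five, sigmaA, Matrix.cons_val, h0, zero_mul,
    zero_add, vertical, LinearMap.restrictScalars_apply] at e
  have e0 := e 0
  have e1 := e 1
  have e2 := e 2
  have e3 := e 3
  simp [boost_basis, rotation_basis] at e0 e1 e2 e3
  obtain ⟨h1, h2, h3, h4⟩ := ht.eq_zero_of_system (a := p 1) (b := p 2) (c := p 3) (d := p 4)
    (fun _ => eq_zero_of_add_self_eq_zero (R := R)) e0 e1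
    (add_neg_eq_zero.1 e2) (eq_neg_of_add_eq_zero_left e3)
  refine ⟨rfl, funext fun k => ?_⟩
  fin_cases k <;> assumption

end Kernel

/-! ### Generators of the kernel -/

section Syzygies

variable {R : Type*} [CommRing R] [Algebra ℝ R]
  {W : Type*} [AddCommGroup W] [Module R W] [Module ℝ W] [IsScalarTower ℝ R W]
  {g : LinearMap.BilinForm R W} {D : Submodule R (derEnd R W)} {θ : Module.Basis (Fin 4) R W}

/-- Elements of `Cl ⊗ D` built from traceless endomorphisms of `W` lie in the kernel as soon as
they annihilate a basis of `W`. -/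
theorem sum_vertical_mem_ker {ι : Type*} [Fintype ι] {T : ι → W →ₗ[R] W}
    (hT : ∀ k, ∑ i, θ.repr (T k (θ i)) i = 0) {m : ι → D} (hm : ∀ k, (m k).1 = vertical (T k))
    {p : ι → Cl g} (hp : ∀ l, ∑ k, p k * clι g (T k (θ l)) = 0) :
    ∑ k, p k ⊗ₜ[R] m k ∈ LinearMap.ker (slashHom g D) := by
  refine mem_ker_slashHom.2 ⟨fun a => ?_, fun w => ?_, fun η => ?_⟩
  · rw [map_sum]
    refine Finset.sum_eq_zero fun k _ => ?_
    rw [actR_tmul, hm]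
    simp [vertical]
  · have h : ∑ k, LinearMap.mulLeft R (p k) ∘ₗ clι g ∘ₗ T k = 0 :=
      θ.ext fun l => by simpa using hp l
    rw [map_sum]
    refine Eq.trans (Finset.sum_congr rfl fun k _ => ?_)
      ((LinearMap.sum_apply _ _ w).symm.trans (LinearMap.congr_fun h w))
    rw [actW_tmul, hm]
    rfl
  · rw [map_sum]
    refine Finset.sum_eq_zero fun k _ => ?_
    rw [actΩ_tmul, hm, extDerTop_vertical_eq_zero θ (hT k), TensorProduct.tmul_zero]

/-- The syzygy `tᵢtⱼ ⊗ σᵢⱼ - tᵢt₀ ⊗ σᵢ + tₖt₀ ⊗ σₖ - tⱼtₖ ⊗ σⱼₖ`, where `tᵢ` denotes `θᵢ` in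
the Clifford algebra. Two of these generate the kernel. -/
theorem syzygy_mem_ker {z : Cl g} (ht : LorentzRelations (fun i => clι g (θ i)) z)
    {i j k : Fin 4} (hi : i ≠ 0) (hj : j ≠ 0) (hk : k ≠ 0) (hij : i ≠ j) (hik : i ≠ k)
    (hjk : j ≠ k) {a b c e : D} (ha : a.1 = vertical (boost θ i)) (hb : b.1 = vertical (boost θ k))
    (hc : c.1 = vertical (rotation θ i j)) (he : e.1 = vertical (rotation θ j k)) :
    (clι g (θ i) * clι g (θ j)) ⊗ₜ[R] c + (-(clι g (θ i) * clι g (θ 0)) ⊗ₜ[R] a +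
      (clι g (θ k) * clι g (θ 0)) ⊗ₜ[R] b - (clι g (θ j) * clι g (θ k)) ⊗ₜ[R] e) ∈
      LinearMap.ker (slashHom g D) := by
  have h := sum_vertical_mem_ker (g := g) (D := D) (θ := θ)
    (T := ![rotation θ i j, boost θ i, boost θ k, rotation θ j k]) (m := ![c, a, b, e])
    (p := ![clι g (θ i) * clι g (θ j), -(clι g (θ i) * clι g (θ 0)), clι g (θ k) * clι g (θ 0),
      -(clι g (θ j) * clι g (θ k))]) ?_ ?_ ?_
  · simp only [Fin.sum_univ_four, Matrix.cons_val] at h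
    convert h using 1
    simp only [TensorProduct.neg_tmul]
    abel
  · intro l
    fin_cases l
    exacts [trace_rotation i j hij, trace_boost i hi, trace_boost k hk, trace_rotation j k hjk]
  · intro l
    fin_cases l <;> assumption
  · intro l
    simp only [Fin.sum_univ_four, Matrix.cons_val, boost_basis, rotation_basis]
    have hl : l = 0 ∨ l = i ∨ l = j ∨ l = k := by omega
    have h1 := ht.mul_sq_zero
    have h2 := fun i hi => ht.mul_sq (i := i) hi
    have h3 := fun i hi => ht.conj_zero (i := i) hi
    have h4 := fun i j hi hij => ht.conj (i := i) (j := j) hi hij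
    rcases hl with rfl | rfl | rfl | rfl
    · simp [hi, hj, hk, h3 i hi, h3 k hk]
    · simp [hi, hij.symm, hik.symm, h1, h2 j hj]
    · simp [hj, hij, hjk.symm, h4 i l hi hij, h2 k hk]
    · simp [hk, hik, hjk, h1, h4 j l hj hjk]

open Module in
/-- `Cl ⊗ D` has a `Cl`-basis whose first nine elements span a complement of the kernel and whose
other two elements are in the kernel: the coefficients `t₁t₂` of `σ₁₂` and `t₁t₃` of `σ₁₃` in the
syzygies are units, so that the syzygies can replace `σ₁₂` and `σ₁₃` in a basis. -/
theorem exists_basis_adapted {z : Cl g} (ht : LorentzRelations (fun i => clι g (θ i)) z)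
    {d : Fin 4 → Derivation ℝ R R} {x : Fin 4 → R} (hx : ∀ i j, d i (x j) = if i = j then 1 else 0)
    (β : Basis ((Fin 4 ⊕ Fin 5) ⊕ Fin 2) R D)
    (hd : ∀ i, (β (.inl (.inl i))).1 = derLift θ (d i))
    (hA : ∀ k, (β (.inl (.inr k))).1 = vertical (sigmaA θ k))
    (hB : ∀ k, (β (.inr k)).1 = vertical (![rotation θ 1 2, rotation θ 1 3] k)) :
    ∃ c : Basis ((Fin 4 ⊕ Fin 5) ⊕ Fin 2) (Cl g) (Cl g ⊗[R] D),
      (∀ i, c (.inl i) = 1 ⊗ₜ[R] β (.inl i)) ∧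
      (∀ k, c (.inr k) ∈ LinearMap.ker (slashHom g D)) ∧
      (∀ k, c (.inr k) ∈ clTensor (clFiltration g 2) D ⊓ clTensor (clParity g 0) D) ∧
      Disjoint (Submodule.span (Cl g) (Set.range (c ∘ Sum.inl)))
        (LinearMap.ker (slashHom g D)) := by
  let b : Basis ((Fin 4 ⊕ Fin 5) ⊕ Fin 2) (Cl g) (Cl g ⊗[R] D) :=
    Algebra.TensorProduct.basis (Cl g) β
  have hb : ∀ i, b i = 1 ⊗ₜ[R] β i := Algebra.TensorProduct.basis_apply β
  let t := fun i => clι g (θ i)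
  let σ : Fin 5 → D := fun k => β (.inl (.inr k))
  -- The syzygies without their first terms. The second one contains `σ₃₂ = -σ₂₃`.
  let r : Fin 2 → Cl g ⊗[R] D :=
    ![-(t 1 * t 0) ⊗ₜ[R] σ 1 + (t 3 * t 0) ⊗ₜ[R] σ 3 - (t 2 * t 3) ⊗ₜ[R] σ 4,
      -(t 1 * t 0) ⊗ₜ[R] σ 1 + (t 2 * t 0) ⊗ₜ[R] σ 2 - (t 3 * t 2) ⊗ₜ[R] ((-1 : R) • σ 4)]
  have hspan (v : Cl g) (k : Fin 5) :
      v ⊗ₜ[R] σ k ∈ Submodule.span (Cl g) (Set.range fun i => b (.inl i)) := by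
    have h1 : v ⊗ₜ[R] σ k = v • b (.inl (.inr k)) := by
      rw [hb, TensorProduct.smul_tmul', smul_eq_mul, mul_one]
    rw [h1]
    exact Submodule.smul_mem _ _ (Submodule.subset_span ⟨_, rfl⟩)
  have hr : ∀ j, r j ∈ Submodule.span (Cl g) (Set.range fun i => b (.inl i)) := by
    intro j
    fin_cases j
    · exact sub_mem (add_mem (hspan _ _) (hspan _ _)) (hspan _ _)
    · refine sub_mem (add_mem (hspan _ _) (hspan _ _)) ?_
      rw [← TensorProduct.smul_tmul]
      exact hspan _ _
  let u : Fin 2 → (Cl g)ˣ :=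
    ![((ht.isUnit 1).mul (ht.isUnit 2)).unit, ((ht.isUnit 1).mul (ht.isUnit 3)).unit]
  obtain ⟨c, hcl, hcr⟩ := exists_basis_triangular b u r hr
  have hc0 : c (.inr 0) = (t 1 * t 2) ⊗ₜ[R] β (.inr 0) + r 0 := by
    rw [hcr, hb, TensorProduct.smul_tmul', smul_eq_mul, mul_one]
    rfl
  have hc1 : c (.inr 1) = (t 1 * t 3) ⊗ₜ[R] β (.inr 1) + r 1 := by
    rw [hcr, hb, TensorProduct.smul_tmul', smul_eq_mul, mul_one]
    rfl
  refine ⟨c, fun i => (hcl i).trans (hb _), fun k => ?_, fun k => ?_, ?_⟩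
  · fin_cases k
    · exact hc0 ▸ syzygy_mem_ker ht (i := 1) (j := 2) (k := 3) (by decide) (by decide) (by decide)
        (by decide) (by decide) (by decide) (hA 1) (hA 3) (hB 0) (hA 4)
    · refine hc1 ▸ syzygy_mem_ker ht (i := 1) (j := 3) (k := 2) (by decide) (by decide)
        (by decide) (by decide) (by decide) (by decide) (hA 1) (hA 2) (hB 1) ?_
      have h : rotation θ 3 2 = -rotation θ 2 3 := θ.ext fun l => by
        simp only [LinearMap.neg_apply, rotation_basis, neg_sub]
      rw [h, Submodule.coe_smul, hA 4, neg_one_smul]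
      exact Subtype.ext (Prod.ext neg_zero rfl)
  · have h (i j : Fin 4) (y : D) : (t i * t j) ⊗ₜ[R] y ∈
        clTensor (clFiltration g 2) D ⊓ clTensor (clParity g 0) D := by
      refine ⟨tmul_mem_clTensor ?_ y, tmul_mem_clTensor ?_ y⟩
      · refine (le_iSup₂ (f := fun (j : ℕ) (_ : j ≤ 2) => LinearMap.range (clι g) ^ j) 2 le_rfl) ?_
        rw [pow_two]
        exact Submodule.mul_mem_mul (LinearMap.mem_range_self _ _) (LinearMap.mem_range_self _ _)
      · exact CliffordAlgebra.ι_mul_ι_mem_evenOdd_zero _ _ _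
    have h' (i j : Fin 4) (y : D) : (-(t i * t j)) ⊗ₜ[R] y ∈
        clTensor (clFiltration g 2) D ⊓ clTensor (clParity g 0) D := by
      rw [TensorProduct.neg_tmul]
      exact neg_mem (h i j y)
    fin_cases k
    · exact hc0 ▸ add_mem (h _ _ _) (sub_mem (add_mem (h' _ _ _) (h _ _ _)) (h _ _ _))
    · exact hc1 ▸ add_mem (h _ _ _) (sub_mem (add_mem (h' _ _ _) (h _ _ _)) (h _ _ _))
  · rw [Submodule.disjoint_def]
    intro y hy hk
    obtain ⟨v, rfl⟩ := (Submodule.mem_span_range_iff_exists_fun _).1 hy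
    have h1 : ∑ i, v i • (c ∘ Sum.inl) i = ∑ i, v (.inl i) ⊗ₜ[R] β (.inl (.inl i)) +
        ∑ k, v (.inr k) ⊗ₜ[R] β (.inl (.inr k)) := by
      simp only [Fintype.sum_sum_type, Function.comp_apply, hcl, hb, TensorProduct.smul_tmul',
        smul_eq_mul, mul_one]
    rw [h1] at hk ⊢
    obtain ⟨h2, h3⟩ := eq_zero_of_sum_mem_ker ht hx (n := fun i => β (.inl (.inl i)))
      (m := fun k => β (.inl (.inr k))) hd hA (u := fun i => v (.inl i))
      (p := fun k => v (.inr k)) hk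
    have h4 (i) : v (.inl i) = 0 := congrFun h2 i
    have h5 (k) : v (.inr k) = 0 := congrFun h3 k
    simp only [h4, h5, TensorProduct.zero_tmul, Finset.sum_const_zero, add_zero]

end Syzygies

/-! ### A basis of the conformal module derivations -/

section Coordinates

open Module

theorem exists_basis_of_coords {R N ι : Type*} [CommRing R] [AddCommMonoid N] [Module R N]
    [Fintype ι] [DecidableEq ι] (F : N →ₗ[R] ι → R) (hF : Function.Injective F) (n : ι → N)
    (hn : ∀ i, F (n i) = Pi.single i 1) : ∃ β : Basis ι R N, ∀ i, β i = n i := by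
  have hs : Function.Surjective F := fun v => ⟨∑ i, v i • n i, by
    simp_rw [map_sum, map_smul, hn]
    exact (pi_eq_sum_univ' v).symm⟩
  let e := LinearEquiv.ofBijective F ⟨hF, hs⟩
  refine ⟨Basis.ofEquivFun e, fun i => ?_⟩
  rw [Basis.coe_ofEquivFun, LinearEquiv.symm_apply_eq]
  exact (hn i).symm

variable {R : Type*} [CommRing R] [Algebra ℝ R]
  {W : Type*} [AddCommGroup W] [Module R W] [Module ℝ W] [IsScalarTower ℝ R W]
  {θ : Basis (Fin 4) R W}

/-- Coordinates of a module derivation with respect to `adaptedFamily`: its values on four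
functions `x` and seven of the entries of its matrix with respect to `θ`. -/
def derCoords (θ : Basis (Fin 4) R W) (x : Fin 4 → R) :
    derEnd R W →ₗ[R] (Fin 4 ⊕ Fin 5) ⊕ Fin 2 → R where
  toFun δ := Sum.elim
    (Sum.elim (fun i => δ.1.1 (x i))
      fun k => θ.repr (δ.1.2 (θ (![0, 0, 0, 0, 3] k))) (![0, 1, 2, 3, 2] k))
    fun k => θ.repr (δ.1.2 (θ (![2, 3] k))) 1
  map_add' δ ε := by ext ((i | i) | i) <;> simp
  map_smul' a δ := by ext ((i | i) | i) <;> simp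

/-- The module derivations `∂₀, …, ∂₃`, then `σ₀, σ₁, σ₂, σ₃, σ₂₃`, then `σ₁₂, σ₁₃`. -/
def adaptedFamily (θ : Basis (Fin 4) R W) (d : Fin 4 → Derivation ℝ R R) :
    (Fin 4 ⊕ Fin 5) ⊕ Fin 2 → derEnd R W :=
  Sum.elim (Sum.elim (fun i => derLift θ (d i)) fun k => vertical (sigmaA θ k))
    fun k => vertical (![rotation θ 1 2, rotation θ 1 3] k)

theorem derLift_basis (X : Derivation ℝ R R) (i : Fin 4) : (derLift θ X).1.2 (θ i) = 0 := by
  simp [derLift, Finsupp.single_apply, apply_ite]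

theorem derCoords_adaptedFamily {d : Fin 4 → Derivation ℝ R R} {x : Fin 4 → R}
    (hx : ∀ i j, d i (x j) = if i = j then 1 else 0) (i : (Fin 4 ⊕ Fin 5) ⊕ Fin 2) :
    derCoords θ x (adaptedFamily θ d i) = Pi.single i 1 := by
  rcases i with (i | i) | i
  · ext ((j | j) | j)
    · change d i (x j) = _
      rw [hx, Pi.single_apply]
      simp [eq_comm]
    · simp [derCoords, adaptedFamily, derLift_basis]
    · simp [derCoords, adaptedFamily, derLift_basis]
  · fin_cases i <;> ext ((j | j) | j)
    all_goals first
      | rfl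
      | fin_cases j <;> simp [derCoords, adaptedFamily, vertical, sigmaA, boost_basis,
          rotation_basis, Finsupp.single_apply]
  · fin_cases i <;> ext ((j | j) | j)
    all_goals first
      | rfl
      | fin_cases j <;> simp [derCoords, adaptedFamily, vertical, rotation_basis]

/-- A conformal module derivation is determined by its adapted coordinates, because the other
entries of its matrix are obtained from the conformal Killing equation. -/
theorem eq_zero_of_derCoords {d : Fin 4 → Derivation ℝ R R} {x : Fin 4 → R}
    (hd : ∀ X : Derivation ℝ R R, X = ∑ i, X (x i) • d i) {g : LinearMap.BilinForm R W}
    (hg : ∀ i j, g (θ i) (θ j) = eta R i j) {δ : derEnd R W} {f : R}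
    (hδ : ∀ v w, δ.1.1 (g v w) = g (δ.1.2 v) w + g v (δ.1.2 w) + f * g v w)
    (h : derCoords θ x δ = 0) : δ = 0 := by
  have hX : δ.1.1 = 0 := by
    rw [hd δ.1.1]
    exact Finset.sum_eq_zero fun i _ => by
      rw [show δ.1.1 (x i) = 0 from congrFun h (.inl (.inl i)), zero_smul]
  let t (i j : Fin 4) : R := θ.repr (δ.1.2 (θ j)) i
  have hl (i : Fin 4) (w : W) : g w (θ i) = eta R i i * θ.repr w i := by
    conv_lhs => rw [← θ.sum_repr w]
    rw [map_sum, LinearMap.sum_apply, Finset.sum_eq_single i]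
    · simp [hg, mul_comm]
    · intro j _ hj
      simp [hg, eta_of_ne hj]
    · simp
  have hr (i : Fin 4) (w : W) : g (θ i) w = eta R i i * θ.repr w i := by
    conv_lhs => rw [← θ.sum_repr w]
    rw [map_sum, Finset.sum_eq_single i]
    · simp [hg, mul_comm]
    · intro j _ hj
      simp [hg, eta_of_ne hj.symm]
    · simp
  -- The conformal Killing equation for two elements of the basis.
  have ht (i j : Fin 4) : eta R j j * t j i + eta R i i * t i j + f * eta R i j = 0 := by
    have h1 := hδ (θ i) (θ j)
    rw [hX, hl j (δ.1.2 (θ i)), hr i (δ.1.2 (θ j)), hg] at h1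
    exact h1.symm
  have h00 : t 0 0 = 0 := congrFun h (.inl (.inr 0))
  have h10 : t 1 0 = 0 := congrFun h (.inl (.inr 1))
  have h20 : t 2 0 = 0 := congrFun h (.inl (.inr 2))
  have h30 : t 3 0 = 0 := congrFun h (.inl (.inr 3))
  have h23 : t 2 3 = 0 := congrFun h (.inl (.inr 4))
  have h12 : t 1 2 = 0 := congrFun h (.inr 0)
  have h13 : t 1 3 = 0 := congrFun h (.inr 1)
  have hf : f = 0 := by simpa [h00, eta] using ht 0 0
  subst hf
  have hi {i : Fin 4} (h0 : i ≠ 0) : t i i = 0 := by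
    have h1 := ht i i
    rw [eta_self h0, one_mul, zero_mul, add_zero] at h1
    exact eq_zero_of_add_self_eq_zero (R := R) h1
  have hT (j i : Fin 4) : t i j = 0 := by
    have e01 := ht 0 1
    have e02 := ht 0 2
    have e03 := ht 0 3
    have e12 := ht 1 2
    have e13 := ht 1 3
    have e23 := ht 2 3
    simp only [h10, h20, h30, h12, h13, h23, eta, Matrix.diagonal_apply_eq, Matrix.cons_val,
      mul_zero, zero_mul, add_zero, zero_add, one_mul, neg_one_mul, neg_eq_zero]
      at e01 e02 e03 e12 e13 e23
    fin_cases i <;> fin_cases j <;> first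
      | assumption
      | exact hi (by decide)
  refine Subtype.ext (Prod.ext hX (LinearMap.ext fun w => ?_))
  have hw (j : Fin 4) : δ.1.2 (θ j) = 0 :=
    θ.repr.map_eq_zero_iff.1 (Finsupp.ext (hT j))
  rw [← θ.sum_repr w, map_sum]
  exact Finset.sum_eq_zero fun j _ => by
    rw [δ.2, hX, hw, Derivation.zero_apply, zero_smul, smul_zero, add_zero]

theorem exists_basis_adaptedFamily {d : Fin 4 → Derivation ℝ R R} {x : Fin 4 → R}
    (hd : ∀ X : Derivation ℝ R R, X = ∑ i, X (x i) • d i)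
    (hx : ∀ i j, d i (x j) = if i = j then 1 else 0) {g : LinearMap.BilinForm R W}
    (hg : ∀ i j, g (θ i) (θ j) = eta R i j) {D : Submodule R (derEnd R W)}
    (hD : ∀ δ ∈ D, ∃ f : R, ∀ v w, δ.1.1 (g v w) = g (δ.1.2 v) w + g v (δ.1.2 w) + f * g v w)
    (hn : ∀ i, adaptedFamily θ d i ∈ D) :
    ∃ β : Basis ((Fin 4 ⊕ Fin 5) ⊕ Fin 2) R D, ∀ i, (β i).1 = adaptedFamily θ d i := by
  have hinj : Function.Injective (derCoords θ x ∘ₗ D.subtype) := by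
    refine (injective_iff_map_eq_zero _).2 fun δ h => ?_
    obtain ⟨f, hf⟩ := hD δ.1 δ.2
    exact Subtype.ext (eq_zero_of_derCoords hd hg hf h)
  obtain ⟨β, hβ⟩ := exists_basis_of_coords _ hinj
    (fun i => ⟨adaptedFamily θ d i, hn i⟩) (derCoords_adaptedFamily hx)
  exact ⟨β, fun i => congrArg Subtype.val (hβ i)⟩

end Coordinates

/-! ### Free pairs -/

theorem map_mk_span_sup_span {R S N ι κ : Type*} [CommRing R] [Ring S] [Algebra R S]
    [AddCommMonoid N] [Module R N] (n : ι ⊕ κ → N) :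
    (Submodule.span R (Set.range fun i => n (.inl i)) ⊔
      Submodule.span R (Set.range fun k => n (.inr k))).map (TensorProduct.mk R S N 1) =
      Submodule.span R (Set.range fun i => (1 : S) ⊗ₜ[R] n i) := by
  rw [← Submodule.span_union, Submodule.map_span, ← Set.Sum.elim_range, ← Set.range_comp]
  congr 2
  ext (i | i) <;> rfl

theorem nonempty_basis_of_finrank_eq {R W : Type*} [CommRing R] [Nontrivial R] [AddCommGroup W]
    [Module R W] [Module.Free R W] {n : ℕ} (hn : n ≠ 0) (h : Module.finrank R W = n) :
    Nonempty (Module.Basis (Fin n) R W) := by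
  have : Module.Finite R W := Module.finite_of_finrank_pos (by omega)
  exact ⟨Module.finBasisOfFinrankEq R W h⟩

section Main

variable {M : Type*} [TopologicalSpace M] [ChartedSpace (EuclideanSpace ℝ (Fin 4)) M]
  {W : Type*} [AddCommGroup W] [Module (Cinf M) W] [Module ℝ W] [IsScalarTower ℝ (Cinf M) W]
  {g : LinearMap.BilinForm (Cinf M) W} {θ : Module.Basis (Fin 4) (Cinf M) W}

/-- A `Cl`-basis of `L̸` that is adapted to `I̸` yields a free pair: the first nine vectors span
`A`, the last two span `B`. -/
theorem isFreePair_of_basis [Nonempty M] {ι κ : Type} [Fintype ι] [Fintype κ]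
    (hι : Fintype.card ι = 9) (hκ : Fintype.card κ = 2)
    (c : Module.Basis (ι ⊕ κ) (Cl g) (slashL g))
    (hA : ∀ i, c (Sum.inl i) ∈ slashLTri g 0) (hB : ∀ j, c (Sum.inr j) ∈ slashITri g 2)
    (hinj : Disjoint (Submodule.span (Cl g) (Set.range (c ∘ Sum.inl))) (slashI g))
    (A B : Submodule (Cinf M) (slashL g))
    (hAc : A = Submodule.span (Cinf M) (Set.range (c ∘ Sum.inl)))
    (hBc : B = Submodule.span (Cinf M) (Set.range (c ∘ Sum.inr))) :
    IsFreePair A B := by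
  have hnt : Nontrivial (Cinf M) := ⟨⟨0, 1, fun h => by
    obtain ⟨p⟩ := ‹Nonempty M›
    have h2 := DFunLike.congr_fun h p
    exact zero_ne_one (α := ℝ) h2⟩⟩
  have leA : A ≤ slashLTri g 0 :=
    hAc ▸ Submodule.span_le.2 (by rintro _ ⟨i, rfl⟩; exact hA i)
  have leB : B ≤ slashITri g 2 :=
    hBc ▸ Submodule.span_le.2 (by rintro _ ⟨i, rfl⟩; exact hB i)
  obtain ⟨h1, h2, h3, h4, h5, h6, h7⟩ := exists_graded_equivs (R := Cinf M) (N := cderEnd g)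
    (I := slashI g) c
    (by
      rintro (i | j)
      · exact (hA i).2
      · exact (hB j).2.2) (fun j => (hB j).1) hinj A B hAc hBc
  exact ⟨leA, leB, h1, h2, h3.trans hι, h4.trans hκ, h5, h6, h7⟩

theorem frameA_eq_span (hθ : IsConfOrthonormal g θ)
    {d : Fin 4 → Derivation ℝ (Cinf M) (Cinf M)} {x : Fin 4 → Cinf M}
    (hd : ∀ X : Derivation ℝ (Cinf M) (Cinf M), X = ∑ i, X (x i) • d i)
    {n : Fin 4 ⊕ Fin 5 → cderEnd g} (hn : ∀ i, (n i).1 = adaptedFamily θ d (.inl i)) :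
    frameA hθ = Submodule.span (Cinf M) (Set.range fun i => (1 : Cl g) ⊗ₜ[Cinf M] n i) := by
  have h1 : LinearMap.range (derLiftC hθ) =
      Submodule.span (Cinf M) (Set.range fun i => n (.inl i)) := by
    apply le_antisymm
    · rintro _ ⟨X, rfl⟩
      rw [hd X, map_sum]
      refine Submodule.sum_mem _ fun i _ => ?_
      rw [map_smul]
      exact Submodule.smul_mem _ _ (Submodule.subset_span ⟨i, Subtype.ext (hn (.inl i))⟩)
    · refine Submodule.span_le.2 ?_
      rintro _ ⟨i, rfl⟩
      exact ⟨d i, Subtype.ext (hn (.inl i)).symm⟩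
  have h2 : ({sigmaDil g, sigmaBoost hθ 1 (by decide), sigmaBoost hθ 2 (by decide),
      sigmaBoost hθ 3 (by decide), sigmaRot hθ 2 3 (by decide) (by decide)} : Set (cderEnd g)) =
      Set.range fun k => n (.inr k) := by
    have h (k : Fin 5) : n (.inr k) = ![sigmaDil g, sigmaBoost hθ 1 (by decide),
        sigmaBoost hθ 2 (by decide), sigmaBoost hθ 3 (by decide),
        sigmaRot hθ 2 3 (by decide) (by decide)] k := by
      refine Subtype.ext ((hn _).trans ?_)
      fin_cases k <;> rfl
    ext y
    simp only [Set.mem_insert_iff, Set.mem_singleton_iff, Set.mem_range]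
    constructor
    · rintro (rfl | rfl | rfl | rfl | rfl)
      exacts [⟨0, h 0⟩, ⟨1, h 1⟩, ⟨2, h 2⟩, ⟨3, h 3⟩, ⟨4, h 4⟩]
    · rintro ⟨k, rfl⟩
      rw [h]
      fin_cases k
      exacts [.inl rfl, .inr (.inl rfl), .inr (.inr (.inl rfl)), .inr (.inr (.inr (.inl rfl))),
        .inr (.inr (.inr (.inr rfl)))]
  exact (congrArg (Submodule.map _) (congrArg₂ (· ⊔ ·) h1 (congrArg _ h2))).trans
    (map_mk_span_sup_span n)

/-- Every conformally orthonormal basis yields a free pair, by an adapted basis of `L̸`. -/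
theorem exists_isFreePair_frameA [IsManifold (𝓡 4) ∞ M]
    (Φ : M ≃ₘ⟮𝓡 4, 𝓡 4⟯ EuclideanSpace ℝ (Fin 4)) (hθ : IsConfOrthonormal g θ) :
    ∃ B : Submodule (Cinf M) (slashL g), IsFreePair (frameA hθ) B := by
  have : Nonempty M := ⟨Φ.symm 0⟩
  obtain ⟨g', hg', horth⟩ := id hθ
  have hd := derivation_eq_sum Φ
  have hx := coordDer_coordFun Φ
  obtain ⟨β, hβ⟩ := exists_basis_adaptedFamily hd hx horth (D := cderEnd g)
    (fun δ hδ => hδ g' hg') (by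
      rintro ((i | k) | k)
      · exact (derLiftC hθ (coordDer Φ i)).2
      · fin_cases k
        exacts [(sigmaDil g).2, (sigmaBoost hθ 1 (by decide)).2, (sigmaBoost hθ 2 (by decide)).2,
          (sigmaBoost hθ 3 (by decide)).2, (sigmaRot hθ 2 3 (by decide) (by decide)).2]
      · fin_cases k
        exacts [(sigmaRot hθ 1 2 (by decide) (by decide)).2,
          (sigmaRot hθ 1 3 (by decide) (by decide)).2])
  obtain ⟨φ, hφ, rfl⟩ := hg'
  obtain ⟨ψ, -, hψ⟩ := exists_mul_eq_one hφ
  have ht := lorentzRelations_of_orthogonal (g := g) (θ := θ) (ψ := ψ)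
    (IsUnit.of_mul_eq_one_right φ hψ) fun i j => by
      rw [← horth i j, LinearMap.smul_apply, LinearMap.smul_apply, smul_eq_mul, ← mul_assoc,
        mul_comm ψ, hψ, one_mul]
  obtain ⟨c, hcl, hker, htri, hdisj⟩ := exists_basis_adapted ht hx β (fun i => hβ (.inl (.inl i)))
    (fun k => hβ (.inl (.inr k))) (fun k => hβ (.inr k))
  refine ⟨_, isFreePair_of_basis (by simp) (by simp) c (fun i => ?_) (fun k => ?_) hdisj _ _ ?_ rfl⟩
  · rw [hcl]
    refine ⟨tmul_mem_clTensor ?_ _, tmul_mem_clTensor ?_ _⟩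
    · refine (le_iSup₂ (f := fun (j : ℕ) (_ : j ≤ 0) => LinearMap.range (clι g) ^ j) 0 le_rfl) ?_
      rw [pow_zero]
      exact Submodule.one_le.1 le_rfl
    · exact CliffordAlgebra.one_le_evenOdd_zero _ (Submodule.one_le.1 le_rfl)
  · exact ⟨hker k, htri k⟩
  · rw [frameA_eq_span hθ hd fun i => hβ (.inl i)]
    congr 2
    funext i
    exact (hcl i).symm

end Main

end GRLie

end

theorem mainTheorem8 {M : Type*} [TopologicalSpace M] [ChartedSpace (EuclideanSpace ℝ (Fin 4)) M]
    [IsManifold (𝓡 4) ∞ M]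
    (hM : Nonempty (M ≃ₘ⟮𝓡 4, 𝓡 4⟯ EuclideanSpace ℝ (Fin 4)))
    {W : Type*} [AddCommGroup W] [Module (Cinf M) W] [Module ℝ W] [IsScalarTower ℝ (Cinf M) W]
    (hfree : Module.Free (Cinf M) W) (hrank : Module.finrank (Cinf M) W = 4)
    (g : LinearMap.BilinForm (Cinf M) W) (hg : IsLorentzian g) :
    (∃ A B : Submodule (Cinf M) (slashL g), IsFreePair A B) ∧
    ∀ (θ : Module.Basis (Fin 4) (Cinf M) W) (hθ : IsConfOrthonormal g θ),
      ∃ B : Submodule (Cinf M) (slashL g), IsFreePair (frameA hθ) B := by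
  obtain ⟨Φ⟩ := hM
  refine ⟨?_, fun θ hθ => exists_isFreePair_frameA Φ hθ⟩
  have h := Φ.toHomeomorph
  have : T2Space M := h.symm.t2Space
  have : SigmaCompactSpace M := h.isClosedEmbedding.sigmaCompactSpace
  have : ContractibleSpace M := h.contractibleSpace
  have : LocallyPathConnectedSpace M :=
    ChartedSpace.locallyPathConnectedSpace (EuclideanSpace ℝ (Fin 4)) M
  have : Nontrivial (Cinf M) := ⟨⟨0, 1, fun h => zero_ne_one (DFunLike.congr_fun h (Φ.symm 0))⟩⟩
  obtain ⟨e⟩ := nonempty_basis_of_finrank_eq (R := Cinf M) (W := W) four_ne_zero hrank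
  obtain ⟨θ, hθ⟩ := hg.exists_orthonormal_basis e
  exact ⟨_, exists_isFreePair_frameA Φ ⟨g, ⟨1, fun _ => zero_lt_one, (one_smul _ _).symm⟩, hθ⟩⟩
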